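/- **Interval exchanges.** An (abstract) interval exchange $\tau$ consists of a base interval and finitely many bands; it is given by two words, listing from left to right the labels of the bands attached along the top and along the bottom of the base interval, in which every label occurs exactly twice in total. Write $\mathcal{ML}(\tau,\mathbb R)$ for the set of assignments of widths $w_a\ge 0$ to the bands for which the total width of the top word (counted with multiplicity) equals that of the bottom word, with its topology as a subset of a Euclidean space, and $\mathcal{ML}(\tau,\mathbb Z)$ for the integer-valued $w\in\mathcal{ML}(\tau,\mathbb R)$; the latter are the integral multicurves carried by $\tau$. **Splitting.** Let $t$ and $b$ be the rightmost labels on the top and on the bottom of $\tau$, and $w\in\mathcal{ML}(\tau,\mathbb R)$. If $w_t>w_b$, then $(\tau,w)$ splits to $(\tau',w')$, written $(\tau,w)\searrow(\tau',w')$, where $\tau'$ is obtained by removing the last letter $b$ of the bottom word and inserting a letter $b$ next to the other occurrence of $t$ (immediately to its right if that occurrence is on the bottom, immediately to its left if it is on the top), and $w'$ agrees with $w$ except that $w'_t=w_t-w_b$. If $w_t<w_b$, do the same with top and bottom exchanged. If $w_t=w_b$, remove both last letters; if $t\ne b$, the bands $t$ and $b$ are amalgamated into one band of the same width, and if $t=b$,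 that band is set aside as an annular loop. Iterating gives the splitting sequence of $(\tau,w)$, which ends when one of the two words is empty. Write $\tau\searrow\tau'$ if $(\tau,w)\searrow(\tau',w')$ for some $w\in\mathcal{ML}(\tau,\mathbb R)$ and some $w'$. **Complete exchanges.** Thickening the base interval and attaching the bands so that the result is an oriented surface, and then gluing a disc to each of its boundary components, gives a closed oriented surface. The discs are the complementary regions of $\tau$; a disc has one cusp for each gap between two consecutive band ends on the top, or on the bottom, of the base interval that lies on its boundary. The exchange $\tau$ is complete of genus $2$ if there are no annular loops, some $w\in\mathcal{ML}(\tau,\mathbb R)$ is positive on every band, every complementary region has exactly three cusps, and the closed surface has genus $2$. Such an exchange has seven bands. Let $\tau_0$ be the complete genus $2$ exchange with top word $1\,2\,3\,4\,2\,3\,4$ and bottom word $5\,6\,7\,5\,6\,7\,1$. **Theorem.** Let $n \geq 0$ and let $$S\colon\quad \tau_0=\sigma_0\searrow\sigma_1\searrow\cdots\searrow\sigma_n$$ be a splitting sequence of complete genus $2$ interval exchanges. Say that $\gamma\in\mathcal{ML}(\tau_0,\mathbb Z)$ exhibits $S$ if the splitting sequence of $(\tau_0,\gamma)$ contains a copy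 of $S$, that is, if there is an $m\ge 0$ such that its stages $m,m+1,\dots,m+n$ exist and, after one renaming of the labels, are $\sigma_0,\sigma_1,\dots,\sigma_n$. Set $$\mathcal S=\{\gamma\in\mathcal{ML}(\tau_0,\mathbb Z) : \gamma\text{ exhibits }S\}.$$ Then for every non-empty bounded (relatively) open subset $U$ of $\mathcal{ML}(\tau_0,\mathbb R)$, $$\frac{\#(\mathcal S\cap tU)}{\#(\mathcal{ML}(\tau_0,\mathbb Z)\cap tU)}\longrightarrow 1\qquad\text{as } t\to\infty.$$ -/

import Mathlib

open Filter Topology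
open scoped Pointwise

/-- The combinatorial data of an (abstract) interval exchange with bands named by labels in `α`.
`top` and `bot` list, from left to right, the labels of the bands attached along the top and along
the bottom of the base interval, so every band is listed twice in all; a band listed once on each
side is orientation preserving, one listed twice on the same side is orientation reversing.
`loops` lists the annular loops that have been split off. -/
@[ext]
structure IntervalExchange (α : Type*) where
  top : List α
  bot : List α
  loops : List α

namespace IntervalExchange

variable {α : Type*} [DecidableEq α]

/-- Each label names at most one band (with exactly two ends) or at most one loop, not both. -/
def WellFormed (τ : IntervalExchange α) : Prop :=
  ∀ a, τ.top.count a + τ.bot.count a + 2 * τ.loops.count a = 0 ∨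
    τ.top.count a + τ.bot.count a + 2 * τ.loops.count a = 2

/-- The bands of the exchange. -/
def bands (τ : IntervalExchange α) : Finset α := (τ.top ++ τ.bot).toFinset

/-- The same exchange with its bands and loops renamed. -/
def relabel (e : Equiv.Perm α) (τ : IntervalExchange α) : IntervalExchange α :=
  ⟨τ.top.map e, τ.bot.map e, τ.loops.map e⟩

/-! ### Weights -/

/-- The space of weights `ML(τ, ℝ)`: nonnegative widths of the bands (and loops), such that the top
and the bottom of the base interval have the same total length. Labels that are not in use get
weight zero. -/
def ML (τ : IntervalExchange α) : Set (α → ℝ) :=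
  {w | (∀ a, 0 ≤ w a) ∧ (∀ a, a ∉ τ.bands → a ∉ τ.loops → w a = 0) ∧
    (τ.top.map w).sum = (τ.bot.map w).sum}

/-- The integral weights `ML(τ, ℤ)`, that is, the integral multicurves carried by `τ`. -/
def MLInt (τ : IntervalExchange α) : Set (α → ℝ) :=
  {w | w ∈ τ.ML ∧ ∀ a, ∃ k : ℤ, w a = k}

/-! ### Splitting -/

/-- One splitting step (Rauzy induction), with the convention that a modified band keeps its label.
Let `t` and `b` be the rightmost bands on the top and on the bottom. If `w t > w b`, the base
interval is shortened by `w b`, the width of `t` is reduced by `w b`, and the rightmost bottom end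
of `b` slides along `t`, to be attached next to the other end of `t`: on its right if that other end
is on the bottom, on its left if it is on the top. The case `w t < w b` is the mirror image. If
`w t = w b`, both rightmost ends are cut off; for `t ≠ b` the bands `t` and `b` are amalgamated
into a single band (named `t`), for `t = b` an annular loop is split off.
There is no further step when nothing is left on the top or on the bottom. -/
noncomputable def split (p : IntervalExchange α × (α → ℝ)) :
    Option (IntervalExchange α × (α → ℝ)) :=
  let (τ, w) := p
  match τ.top.getLast?, τ.bot.getLast? with
  | some t, some b =>
    let T := τ.top.dropLast
    let B := τ.bot.dropLast
    if w b < w t then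
      some (⟨T.flatMap (fun x => if x = t then [b, t] else [x]) ++ [t],
             B.flatMap (fun x => if x = t then [t, b] else [x]), τ.loops⟩,
        Function.update w t (w t - w b))
    else if w t < w b then
      some (⟨T.flatMap (fun x => if x = b then [b, t] else [x]),
             B.flatMap (fun x => if x = b then [t, b] else [x]) ++ [b], τ.loops⟩,
        Function.update w b (w b - w t))
    else if t = b then
      some (⟨T, B, t :: τ.loops⟩, w)
    else
      some (⟨T.map (fun x => if x = b then t else x),
             B.map (fun x => if x = b then t else x), τ.loops⟩,
        Function.update w b 0)
  | _, _ => none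

/-- The `m`-th stage of the splitting sequence of `(τ, w)`; it is `none` from the moment on that the
sequence has terminated. -/
noncomputable def splitSeq (τ : IntervalExchange α) (w : α → ℝ) (m : ℕ) :
    Option (IntervalExchange α × (α → ℝ)) :=
  (fun q => q.bind split)^[m] (some (τ, w))

/-- `τ ↘ τ'`: for some weights `w` on `τ`, the pair `(τ, w)` splits to `(τ', w')`. -/
def SplitsTo (τ τ' : IntervalExchange α) : Prop :=
  ∃ w ∈ τ.ML, ∃ w', split (τ, w) = some (τ', w')

/-! ### Complete exchanges -/

/-- `τ` carries a weight that is positive on every band. -/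
def Recurrent (τ : IntervalExchange α) : Prop :=
  ∃ w ∈ τ.ML, ∀ a ∈ τ.bands, 0 < w a

/-- The band ends in their cyclic order around the (thickened) base interval: the top from left to
right, then the bottom from right to left. -/
def ends (τ : IntervalExchange α) : List α := τ.top ++ τ.bot.reverse

/-- The gap number `i` is the arc of the boundary of the thickened base interval between the
band ends number `i` and `i + 1` (cyclically). Walking along the boundary of the complement, one
passes from gap `i` along the near side of the band attached at end `i + 1`, and arrives at gap `j`,
where `j` is the number of the other end of that band. -/
def GapStep (τ : IntervalExchange α) (i j : Fin τ.ends.length) : Prop :=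
  j ≠ finRotate _ i ∧ τ.ends.get j = τ.ends.get (finRotate _ i)

/-- The complementary regions of the exchange in the closed surface that is obtained by gluing a
disc to each boundary component of the union of the thickened base interval and the bands: each
region is the set of the gaps along its boundary. -/
def Region (τ : IntervalExchange α) : Type := Quot τ.GapStep

/-- Every gap is a cusp of the adjacent complementary region, except for the two vertical sides of
the thickened base interval, which are smooth: the right one comes just after the last end on the
top, the left one just after the last entry of `ends`. -/
def IsCusp (τ : IntervalExchange α) (i : Fin τ.ends.length) : Prop :=
  i.val + 1 ≠ τ.top.length ∧ i.val + 1 ≠ τ.ends.length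

/-- The number of cusps of a complementary region. -/
noncomputable def cusps (τ : IntervalExchange α) (R : τ.Region) : ℕ :=
  Nat.card {i : Fin τ.ends.length // τ.IsCusp i ∧ Quot.mk _ i = R}

/-- The Euler characteristic of the closed surface: one disc for the base interval, one strip for
each band, and one disc for each complementary region. -/
noncomputable def eulerChar (τ : IntervalExchange α) : ℤ :=
  1 - τ.bands.card + Nat.card τ.Region

/-- `τ` is a complete interval exchange on the closed (oriented) surface of genus `g`: it is
recurrent and all its complementary regions are ideal triangles. -/
def IsComplete (g : ℕ) (τ : IntervalExchange α) : Prop :=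
  τ.WellFormed ∧ τ.loops = [] ∧ τ.Recurrent ∧ (∀ R : τ.Region, τ.cusps R = 3) ∧
    τ.eulerChar = 2 - 2 * (g : ℤ)

/-! ### Exhibiting a splitting sequence -/

/-- `γ` exhibits the sequence `σ 0 ↘ σ 1 ↘ ⋯ ↘ σ n`: some consecutive stages of the splitting
sequence of `(τ, γ)` form a copy of it, that is, they agree with it after one renaming of the
labels. -/
def Exhibits (τ : IntervalExchange α) (γ : α → ℝ) {n : ℕ}
    (σ : Fin (n + 1) → IntervalExchange α) : Prop :=
  ∃ (m : ℕ) (e : Equiv.Perm α), ∀ i : Fin (n + 1),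
    (splitSeq τ γ (m + i)).map Prod.fst = some ((σ i).relabel e)

/-- The standard complete genus 2 exchange `(1 2 3 4 2 3 4 / 5 6 7 5 6 7 1)`, its bands being
numbered from `0` to `6` here. -/
def standard : IntervalExchange (Fin 7) :=
  ⟨[0, 1, 2, 3, 1, 2, 3], [4, 5, 6, 4, 5, 6, 0], []⟩

end IntervalExchange

/-!
Almost every real weight on `standard` has a splitting sequence that contains a copy of the given
sequence `S`, and whether it does so within finitely many strict steps is an open condition that
does not change under scaling. Hence the weights of bounded total width that do not exhibit `S` in
this way form a compact null set, star-shaped at the origin, and the number of integral points in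
its dilates is `o(t ^ 6)` (`tendsto_card_not_seen`), whereas a non-empty relatively open set
of weights contains at least `c * t ^ 6` integral points after dilation by `t` (`exists_le_ncard`).

**The combinatorics.** Let the returning exchanges be those that can be split to a renaming of
`standard`. Up to renaming there are 402 of them. They are found by a backward search, and a
computation in the kernel (`nodes_check`) shows that a strict splitting step of a returning exchange
leads to a returning exchange, or to one without positive weights. Every returning exchange has a
path to `standard` (`Returning.exists_path`), and from there to an exchange with any prescribed
label at its right end (`Returning.exists_path_to`). A sequence `S` of complete exchanges has
strict steps only, since complete exchanges of genus two have seven bands, so it is given by a word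
in two letters (`exists_word`).

**The measure theory.** A stage of the splitting process is described by the parametrization of the
weights at this stage by the original ones, and by lengths of the bands such that the area, the sum
of the products of widths and lengths, does not change (`State`). A strict step subtracts the width
of the loser from the one of the winner, and adds the length of the winner to the one of the loser.
The role of the length of a band `a` is played by its rate, the least area of a weight that is one
on `a`. Rates do not decrease; the rate of a loser becomes at least the rate of the winner; and the
greatest rate grows at most by a constant factor in one step. All probabilities are bounded below by
means of homotheties of the convex set of weights of area at most one: a step in which the loser
has a rate comparable with the greatest one has a probability bounded below
(`State.volume_le_child`), and with a probability bounded below no band is much narrower than the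
inverse of the greatest rate (`State.volume_le_wide`).

The probability that a copy of `S` follows is bounded below uniformly in all stages
(`State.exists_volume_le_hits`), by descending induction on the number of bands whose rates are
comparable with the greatest one. If these are all the bands, one can prescribe the next steps.
Otherwise let `A` be the set of these bands. One can prescribe steps between bands of `A` until a
band outside of `A` gets to the right end. From then on, as long as no band of `A` wins, there is
always a band outside of `A` at the right end, namely the last winner. If the bands of `A` are not
too narrow, their rates stay bounded in the meantime, and since the sum of the lengths grows by a
definite amount in each step, some band outside of `A` has to reach a comparable rate after
finitely many steps, at the latest when it loses to a band of `A` (`State.volume_wide_le`).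

Finally, a uniform lower bound implies that the exceptional set is null
(`State.volume_region_diff_hits`): it can be approximated from outside by unions of cylinders, and
in each of these its proportion is at most a constant less than one.
-/

namespace IntervalExchange

open MeasureTheory
open scoped ENNReal NNReal

/-! ### The search for returning exchanges -/

/-- The rightmost label on the top. -/
def lastTop (τ : IntervalExchange (Fin 7)) : Fin 7 := τ.top.getLastD 0

/-- The rightmost label on the bottom. -/
def lastBot (τ : IntervalExchange (Fin 7)) : Fin 7 := τ.bot.getLastD 0

/-- The wider one of the two rightmost bands; `c = true` means that it is attached to the top. -/
def winner (c : Bool) (τ : IntervalExchange (Fin 7)) : Fin 7 := cond c τ.lastTop τ.lastBot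

/-- The narrower one of the two rightmost bands; `c = true` means that it is attached to the
bottom. -/
def loser (c : Bool) (τ : IntervalExchange (Fin 7)) : Fin 7 := cond c τ.lastBot τ.lastTop

/-- The exchange after a splitting step in which the rightmost band on the top (`c = true`) or on
the bottom (`c = false`) is strictly wider than its opponent. -/
def move (c : Bool) (τ : IntervalExchange (Fin 7)) : IntervalExchange (Fin 7) :=
  let T := τ.top.dropLast.flatMap
    fun x => if x = τ.winner c then [τ.lastBot, τ.lastTop] else [x]
  let B := τ.bot.dropLast.flatMap
    fun x => if x = τ.winner c then [τ.lastTop, τ.lastBot] else [x]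
  ⟨cond c (T ++ [τ.lastTop]) T, cond c B (B ++ [τ.lastBot]), τ.loops⟩

/-- The encoding of an exchange, up to renaming of the bands, by a number: its octal digits are
`1`, the top word, `7`, and the bottom word, where the bands are numbered in the order of their
first appearance. The variables `f`, `m`, `n` hold the numbers given so far (shifted by one, as the
octal digits of `f`), how many of them there are, and the digits written so far. Recursors stand in
for structural recursion here and in `memb`, because the kernel is to evaluate these functions. -/
noncomputable def code (τ : IntervalExchange (Fin 7)) : ℕ :=
  let write (a : Fin 7) (k : ℕ → ℕ → ℕ → ℕ) (f m n : ℕ) : ℕ :=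
    Nat.rec (k (f + (m + 1) * 8 ^ a.val) (m + 1) (8 * n + m)) (fun j _ => k f m (8 * n + j))
      (f / 8 ^ a.val % 8)
  let scan (l : List (Fin 7)) (k : ℕ → ℕ → ℕ → ℕ) : ℕ → ℕ → ℕ → ℕ :=
    List.rec k (fun a _ => write a) l
  scan τ.top (fun f m n => scan τ.bot (fun _ _ n => n) f m (8 * n + 7)) 0 0 1

/-- The last `k` octal digits of `n`, followed by `l`. -/
def octal : ℕ → ℕ → List ℕ → List ℕ
  | 0, _, l => l
  | k + 1, n, l => octal k (n / 8) (n % 8 :: l)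

/-- The exchange with a given code. -/
def decode (n : ℕ) : IntervalExchange (Fin 7) :=
  let l := octal 15 n []
  ⟨(l.takeWhile (· ≠ 7)).map (Fin.ofNat 7), ((l.dropWhile (· ≠ 7)).drop 1).map (Fin.ofNat 7), []⟩

/-- Whether `n` is an entry of `l`. -/
noncomputable def memb (n : ℕ) (l : List ℕ) : Bool :=
  List.rec false (fun m _ r => Bool.rec r true (Nat.beq n m)) l

theorem memb_iff (n : ℕ) (l : List ℕ) : memb n l = true ↔ n ∈ l := by
  induction l with
  | nil => simp [memb]
  | cons m l ih =>
    have h : memb n (m :: l) = Bool.rec (memb n l) true (Nat.beq n m) := rfl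
    rw [h]
    cases hb : Nat.beq n m
    · have : n ≠ m := fun h => by simp [h] at hb
      simp [ih, this]
    · have : n = m := Nat.eq_of_beq_eq_true hb
      simp [this]

/-- Takes out the letter that follows the first `x`. -/
def takeAfter (x : Fin 7) : List (Fin 7) → Option (Fin 7 × List (Fin 7))
  | [] => none
  | [_] => none
  | a :: y :: l =>
    if a = x then some (y, a :: l) else (takeAfter x (y :: l)).map fun p => (p.1, a :: p.2)

/-- The words of an exchange that becomes `(T, B)` by a splitting step in which the rightmost band
on the top is wider. -/
def undoTop (T B : List (Fin 7)) : Option (List (Fin 7) × List (Fin 7)) :=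
  let x := T.getLastD 0
  match takeAfter x T.dropLast.reverse with
  | some (y, T') => some (T'.reverse ++ [x], B ++ [y])
  | none => (takeAfter x B).map fun p => (T, p.2 ++ [p.1])

/-- Backward search: `l` is the list of the codes found so far, `q` the queue of those among them
that have not been treated yet. The local function `push` adds the code of a predecessor `p`, if
there is one and its code is new, and goes on with `K`. -/
noncomputable def search (k : ℕ) : List ℕ → List ℕ → List ℕ :=
  Nat.rec (fun _ l => l) (fun _ next q l =>
    match q with
    | [] => l
    | n :: q =>
      let τ := decode n
      let push (p : Option (IntervalExchange (Fin 7))) (K : List ℕ → List ℕ → List ℕ)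
          (q l : List ℕ) : List ℕ :=
        match p with
        | none => K q l
        | some σ => bif memb (code σ) l then K q l else K (q ++ [code σ]) (code σ :: l)
      push ((undoTop τ.top τ.bot).map fun p => ⟨p.1, p.2, []⟩)
        (push ((undoTop τ.bot τ.top).map fun p => ⟨p.2, p.1, []⟩) next) q l) k

/-- The codes of the exchanges that can be split to `standard`, up to renaming. -/
noncomputable def nodes : List ℕ := search 500 [code standard] [code standard]

/-- The numbering of the bands in the order of their first appearance: `a` gets the number
`f / 8 ^ a % 8 - 1`, where `f` is the value of this function. -/
noncomputable def numbering (τ : IntervalExchange (Fin 7)) : ℕ :=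
  let scan (l : List (Fin 7)) (k : ℕ → ℕ → ℕ) : ℕ → ℕ → ℕ :=
    List.rec k (fun a _ k f m => Nat.rec (k (f + (m + 1) * 8 ^ a.val) (m + 1)) (fun _ _ => k f m)
      (f / 8 ^ a.val % 8)) l
  scan τ.top (scan τ.bot (fun f _ => f)) 0 0

/-- The number of the band `a` in the order of first appearance. -/
noncomputable def number (τ : IntervalExchange (Fin 7)) (a : Fin 7) : Fin 7 :=
  Fin.ofNat 7 (τ.numbering / 8 ^ a.val % 8 - 1)

/-- Every label has exactly two ends on the base interval. -/
def Balanced (τ : IntervalExchange (Fin 7)) : Prop := ∀ a, τ.top.count a + τ.bot.count a = 2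

instance (τ : IntervalExchange (Fin 7)) : Decidable τ.Balanced :=
  inferInstanceAs (Decidable (∀ a, τ.top.count a + τ.bot.count a = 2))

/-- One side has more ends than the other, and no orientation reversing band on the latter. -/
def OneSided (τ : IntervalExchange (Fin 7)) : Prop :=
  (τ.top.length < τ.bot.length ∧ τ.top.Nodup) ∨ (τ.bot.length < τ.top.length ∧ τ.bot.Nodup)

instance (τ : IntervalExchange (Fin 7)) : Decidable τ.OneSided := by
  unfold OneSided; infer_instance

/-- Whether `τ` is one-sided or, up to a renaming of the bands, encoded by an entry of `N`. -/
noncomputable def listed (N : List ℕ) (τ : IntervalExchange (Fin 7)) : Bool :=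
  bif memb (code τ) N then
    decide (τ.top.map τ.number = (decode (code τ)).top ∧ τ.bot.map τ.number = (decode (code τ)).bot)
  else decide τ.OneSided

/-- Whether the exchange with code `n` is well-formed and splits only to exchanges encoded in `N`
or to one-sided ones. -/
noncomputable def closedAt (N : List ℕ) (n : ℕ) : Bool :=
  decide ((decode n).top ≠ [] ∧ (decode n).bot ≠ [] ∧ (decode n).lastTop ≠ (decode n).lastBot ∧
    (decode n).Balanced) && (listed N ((decode n).move true) && listed N ((decode n).move false))

/-- Whether each entry of `l`, except for the code of `standard`, splits to a later one. -/
noncomputable def descends (l : List ℕ) : Bool :=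
  List.rec true (fun n l r => (Nat.beq n (code standard) || (memb (code ((decode n).move true)) l ||
    memb (code ((decode n).move false)) l)) && r) l

/-- The outcome of the search: the exchanges that were found are well-formed, they are closed under
those splitting steps that do not lead to one-sided exchanges, and each of them, except for
`standard`, splits to one that was found before. -/
theorem nodes_check :
    (nodes.all (closedAt nodes) && descends nodes && Nat.ble nodes.length 402 &&
      memb (code standard) nodes &&
      decide ((decode (code standard)).top = standard.top ∧
        (decode (code standard)).bot = standard.bot)) = true := by
  decide +kernel

/-! ### Counting ends -/

theorem count_flatMap_insert {α : Type*} [DecidableEq α] (L : List α) (p q w y a : α)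
    (h : ∀ z, [p, q].count z = [w].count z + [y].count z) :
    (L.flatMap fun x => if x = w then [p, q] else [x]).count a =
      L.count a + if y = a then L.count w else 0 := by
  induction L with
  | nil => simp
  | cons x L ih =>
    rw [List.flatMap_cons, List.count_append, ih]
    by_cases hx : x = w
    · subst hx
      have := h a
      simp only [if_true, List.count_cons, List.count_nil, beq_iff_eq] at this ⊢
      split_ifs at this ⊢ <;> omega
    · simp only [if_neg hx, List.count_cons, List.count_nil, beq_iff_eq]
      split_ifs <;> omega

section

variable {τ : IntervalExchange (Fin 7)}

theorem dropLast_append_lastTop (h : τ.top ≠ []) : τ.top.dropLast ++ [τ.lastTop] = τ.top := by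
  rw [lastTop, List.getLastD_eq_getLast?, List.getLast?_eq_some_getLast h, Option.getD_some]
  exact List.dropLast_append_getLast h

theorem dropLast_append_lastBot (h : τ.bot ≠ []) : τ.bot.dropLast ++ [τ.lastBot] = τ.bot := by
  rw [lastBot, List.getLastD_eq_getLast?, List.getLast?_eq_some_getLast h, Option.getD_some]
  exact List.dropLast_append_getLast h

theorem move_true (τ : IntervalExchange (Fin 7)) : τ.move true =
    ⟨(τ.top.dropLast.flatMap fun x => if x = τ.lastTop then [τ.lastBot, τ.lastTop] else [x]) ++
        [τ.lastTop],
      τ.bot.dropLast.flatMap fun x => if x = τ.lastTop then [τ.lastTop, τ.lastBot] else [x],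
      τ.loops⟩ := rfl

theorem move_false (τ : IntervalExchange (Fin 7)) : τ.move false =
    ⟨τ.top.dropLast.flatMap fun x => if x = τ.lastBot then [τ.lastBot, τ.lastTop] else [x],
      (τ.bot.dropLast.flatMap fun x => if x = τ.lastBot then [τ.lastTop, τ.lastBot] else [x]) ++
        [τ.lastBot],
      τ.loops⟩ := rfl

theorem Balanced.move (hτ : τ.Balanced) (ht : τ.top ≠ []) (hb : τ.bot ≠ [])
    (hne : τ.lastTop ≠ τ.lastBot) (c : Bool) : (τ.move c).Balanced := by
  have key : ∀ a, τ.top.dropLast.count a + [τ.lastTop].count a +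
      (τ.bot.dropLast.count a + [τ.lastBot].count a) = 2 := fun a => by
    rw [← List.count_append, ← List.count_append, dropLast_append_lastTop ht,
      dropLast_append_lastBot hb]
    exact hτ a
  intro a
  have h1 := key a
  cases c
  · have h2 := key τ.lastBot
    simp only [move_false, List.count_append]
    rw [count_flatMap_insert _ _ _ _ τ.lastTop a, count_flatMap_insert _ _ _ _ τ.lastTop a]
    · simp only [List.count_singleton, beq_iff_eq, hne, if_false, if_true] at h1 h2 ⊢
      split_ifs at h1 h2 ⊢ <;> omega
    · intro z
      simp only [List.count_cons, List.count_nil]; omega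
    · intro z
      simp only [List.count_cons, List.count_nil]; omega
  · have h2 := key τ.lastTop
    simp only [move_true, List.count_append]
    rw [count_flatMap_insert _ _ _ _ τ.lastBot a, count_flatMap_insert _ _ _ _ τ.lastBot a]
    · simp only [List.count_singleton, beq_iff_eq, hne.symm, if_false, if_true] at h1 h2 ⊢
      split_ifs at h1 h2 ⊢ <;> omega
    · intro z
      simp only [List.count_cons, List.count_nil]; omega
    · intro z
      simp only [List.count_cons, List.count_nil]; omega

/-! ### Renaming -/

theorem lastTop_relabel (e : Equiv.Perm (Fin 7)) (ht : τ.top ≠ []) :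
    (τ.relabel e).lastTop = e τ.lastTop := by
  simp [lastTop, relabel, List.getLastD_eq_getLast?, List.getLast?_eq_some_getLast ht]

theorem lastBot_relabel (e : Equiv.Perm (Fin 7)) (hb : τ.bot ≠ []) :
    (τ.relabel e).lastBot = e τ.lastBot := by
  simp [lastBot, relabel, List.getLastD_eq_getLast?, List.getLast?_eq_some_getLast hb]

theorem relabel_relabel (e f : Equiv.Perm (Fin 7)) (τ : IntervalExchange (Fin 7)) :
    (τ.relabel f).relabel e = τ.relabel (e * f) := by
  simp [relabel]

theorem relabel_one (τ : IntervalExchange (Fin 7)) : τ.relabel 1 = τ := by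
  simp [relabel]

theorem move_relabel (e : Equiv.Perm (Fin 7)) (ht : τ.top ≠ []) (hb : τ.bot ≠ []) (c : Bool) :
    (τ.relabel e).move c = (τ.move c).relabel e := by
  have hw : (τ.relabel e).winner c = e (τ.winner c) := by
    cases c <;> simp [winner, lastTop_relabel e ht, lastBot_relabel e hb]
  have key : ∀ (L : List (Fin 7)) (p q w : Fin 7),
      (L.map e).flatMap (fun x => if x = e w then [e p, e q] else [x]) =
        (L.flatMap fun x => if x = w then [p, q] else [x]).map e := by
    intro L p q w
    rw [List.flatMap_map, List.map_flatMap]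
    congr 1
    funext x
    by_cases hx : x = w <;> simp [hx]
  have h1 : (τ.relabel e).top.dropLast = τ.top.dropLast.map e := by
    simp [relabel, List.map_dropLast]
  have h2 : (τ.relabel e).bot.dropLast = τ.bot.dropLast.map e := by
    simp [relabel, List.map_dropLast]
  simp only [IntervalExchange.move, hw, h1, h2, lastTop_relabel e ht, lastBot_relabel e hb, key]
  cases c <;> simp [relabel]

theorem Balanced.relabel (hτ : τ.Balanced) (e : Equiv.Perm (Fin 7)) : (τ.relabel e).Balanced := by
  intro a
  obtain ⟨b, rfl⟩ := e.surjective a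
  simpa [IntervalExchange.relabel, List.count_map_of_injective _ _ e.injective] using hτ b

/-! ### Returning exchanges -/

/-- The exchanges on the label set `Fin 7` that can be split to a renaming of `standard`. -/
def Returning (τ : IntervalExchange (Fin 7)) : Prop :=
  ∃ (e : Equiv.Perm (Fin 7)) (n : ℕ), n ∈ nodes ∧ τ = (decode n).relabel e

theorem Returning.relabel (hτ : τ.Returning) (e : Equiv.Perm (Fin 7)) :
    (τ.relabel e).Returning := by
  obtain ⟨f, n, hn, rfl⟩ := hτ
  exact ⟨e * f, n, hn, relabel_relabel _ _ _⟩

theorem decode_code_standard : decode (code standard) = standard := by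
  have h := nodes_check
  simp only [Bool.and_eq_true, decide_eq_true_eq] at h
  exact IntervalExchange.ext h.2.1 h.2.2 rfl

theorem standard_returning : standard.Returning := by
  have h := nodes_check
  simp only [Bool.and_eq_true, decide_eq_true_eq, memb_iff] at h
  exact ⟨1, code standard, h.1.2, by rw [relabel_one, decode_code_standard]⟩

theorem closedAt_of_mem {n : ℕ} (hn : n ∈ nodes) : closedAt nodes n = true := by
  have h := nodes_check
  simp only [Bool.and_eq_true, List.all_eq_true] at h
  exact h.1.1.1.1 n hn

theorem wellFormed_of_mem {n : ℕ} (hn : n ∈ nodes) : (decode n).top ≠ [] ∧ (decode n).bot ≠ [] ∧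
    (decode n).lastTop ≠ (decode n).lastBot ∧ (decode n).Balanced := by
  have h := closedAt_of_mem hn
  rw [closedAt, Bool.and_eq_true, decide_eq_true_eq] at h
  exact h.1

namespace Returning

theorem top_ne_nil (hτ : τ.Returning) : τ.top ≠ [] := by
  obtain ⟨e, n, hn, rfl⟩ := hτ
  simpa [IntervalExchange.relabel] using (wellFormed_of_mem hn).1

theorem bot_ne_nil (hτ : τ.Returning) : τ.bot ≠ [] := by
  obtain ⟨e, n, hn, rfl⟩ := hτ
  simpa [IntervalExchange.relabel] using (wellFormed_of_mem hn).2.1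

theorem lastTop_ne_lastBot (hτ : τ.Returning) : τ.lastTop ≠ τ.lastBot := by
  obtain ⟨e, n, hn, rfl⟩ := hτ
  obtain ⟨h1, h2, h3, -⟩ := wellFormed_of_mem hn
  rw [lastTop_relabel e h1, lastBot_relabel e h2]
  exact e.injective.ne h3

theorem balanced (hτ : τ.Returning) : τ.Balanced := by
  obtain ⟨e, n, hn, rfl⟩ := hτ
  exact (wellFormed_of_mem hn).2.2.2.relabel e

end Returning

theorem sum_map_eq_sum_count (l : List (Fin 7)) (w : Fin 7 → ℝ) :
    (l.map w).sum = ∑ a, (l.count a : ℝ) * w a := by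
  induction l with
  | nil => simp
  | cons b l ih =>
    rw [List.map_cons, List.sum_cons, ih]
    simp only [List.count_cons, Nat.cast_add, add_mul, Finset.sum_add_distrib]
    simp [add_comm]

theorem OneSided.sum_ne (h : τ.OneSided) (hτ : τ.Balanced) (w : Fin 7 → ℝ) (hw : ∀ a, 0 < w a) :
    (τ.top.map w).sum ≠ (τ.bot.map w).sum := by
  have aux : ∀ S T : List (Fin 7), (∀ a, S.count a + T.count a = 2) → S.length < T.length →
      S.Nodup → (S.map w).sum < (T.map w).sum := by
    intro S T h2 hl hn
    have hle : ∀ a, S.count a ≤ T.count a := fun a => by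
      have := h2 a
      have := List.nodup_iff_count_le_one.1 hn a
      omega
    rw [sum_map_eq_sum_count, sum_map_eq_sum_count]
    apply Finset.sum_lt_sum
    · intro a _
      exact mul_le_mul_of_nonneg_right (by exact_mod_cast hle a) (hw a).le
    · by_contra hcon
      have heq : ∀ a, S.count a = T.count a := by
        intro a
        by_contra hne
        refine hcon ⟨a, Finset.mem_univ a, mul_lt_mul_of_pos_right ?_ (hw a)⟩
        exact_mod_cast lt_of_le_of_ne (hle a) hne
      exact hl.ne (List.perm_iff_count.2 heq).length_eq
  rcases h with ⟨hl, hn⟩ | ⟨hl, hn⟩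
  · exact (aux _ _ hτ hl hn).ne
  · exact (aux _ _ (fun a => by rw [add_comm]; exact hτ a) hl hn).ne'

theorem returning_or_oneSided_of_listed {τ : IntervalExchange (Fin 7)} (h : listed nodes τ = true)
    (hl : τ.loops = []) (hσ : ∀ n ∈ nodes, (decode n).Balanced) :
    (τ.Returning ∧ ∃ e, τ = (decode (code τ)).relabel e) ∨ (code τ ∉ nodes ∧ τ.OneSided) := by
  unfold listed at h
  by_cases hm : memb (code τ) nodes = true
  · rw [hm, cond_true, decide_eq_true_eq] at h
    have hmem := (memb_iff _ _).1 hm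
    left
    have hsurj : Function.Surjective τ.number := by
      intro i
      have h2 := hσ _ hmem i
      have : i ∈ (decode (code τ)).top ∨ i ∈ (decode (code τ)).bot := by
        rw [← List.count_pos_iff, ← List.count_pos_iff]; omega
      rw [← h.1, ← h.2] at this
      rcases this with h | h <;> obtain ⟨a, -, ha⟩ := List.mem_map.1 h <;> exact ⟨a, ha⟩
    let e : Equiv.Perm (Fin 7) := Equiv.ofBijective _ (Finite.surjective_iff_bijective.1 hsurj)
    have he : τ = (decode (code τ)).relabel e⁻¹ := by
      have : (decode (code τ)) = τ.relabel e := by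
        refine IntervalExchange.ext h.1.symm h.2.symm ?_
        simp [IntervalExchange.relabel, hl, decode]
      conv_rhs => rw [this, relabel_relabel, inv_mul_cancel, relabel_one]
    exact ⟨⟨_, _, hmem, he⟩, _, he⟩
  · right
    rw [Bool.not_eq_true] at hm
    rw [hm, cond_false, decide_eq_true_eq] at h
    exact ⟨fun h' => by simp [(memb_iff _ _).2 h'] at hm, h⟩

theorem move_decode {n : ℕ} (hn : n ∈ nodes) (c : Bool) :
    (((decode n).move c).Returning ∧
      ∃ e, (decode n).move c = (decode (code ((decode n).move c))).relabel e) ∨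
    (code ((decode n).move c) ∉ nodes ∧ ((decode n).move c).OneSided) := by
  have h := closedAt_of_mem hn
  rw [closedAt, Bool.and_eq_true, Bool.and_eq_true] at h
  refine returning_or_oneSided_of_listed ?_ rfl fun n hn => (wellFormed_of_mem hn).2.2.2
  cases c
  exacts [h.2.2, h.2.1]

/-- A splitting step either stays among the returning exchanges or makes some band ends
unbalanced, so that no positive weights are left. -/
theorem Returning.move_or (hτ : τ.Returning) (c : Bool) : (τ.move c).Returning ∨
    ∀ w : Fin 7 → ℝ, (∀ a, 0 < w a) →
      ((τ.move c).top.map w).sum ≠ ((τ.move c).bot.map w).sum := by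
  have hbal := hτ.balanced.move hτ.top_ne_nil hτ.bot_ne_nil hτ.lastTop_ne_lastBot c
  obtain ⟨e, n, hn, rfl⟩ := hτ
  have hw := wellFormed_of_mem hn
  rw [move_relabel e hw.1 hw.2.1] at hbal ⊢
  rcases move_decode hn c with ⟨h, -⟩ | ⟨-, h⟩
  · exact .inl (h.relabel e)
  · right
    refine OneSided.sum_ne ?_ hbal
    simpa [OneSided, IntervalExchange.relabel, List.nodup_map_iff e.injective] using h

/-! ### Paths -/

/-- The exchange that is reached by a sequence of strict splitting steps. -/
def run : List Bool → IntervalExchange (Fin 7) → IntervalExchange (Fin 7)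
  | [], τ => τ
  | c :: u, τ => run u (τ.move c)

/-- All the exchanges along a sequence of splitting steps are returning. -/
def Admissible : List Bool → IntervalExchange (Fin 7) → Prop
  | [], τ => τ.Returning
  | c :: u, τ => τ.Returning ∧ Admissible u (τ.move c)

theorem Admissible.start {u : List Bool} (h : Admissible u τ) : τ.Returning := by
  cases u
  exacts [h, h.1]

theorem Admissible.run {u : List Bool} : ∀ {τ : IntervalExchange (Fin 7)}, Admissible u τ →
    (run u τ).Returning := by
  induction u with
  | nil => exact fun h => h
  | cons c u ih => exact fun h => ih h.2

theorem run_append (u v : List Bool) (τ : IntervalExchange (Fin 7)) :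
    run (u ++ v) τ = run v (run u τ) := by
  induction u generalizing τ with
  | nil => rfl
  | cons c u ih => exact ih _

theorem admissible_append {u v : List Bool} : Admissible (u ++ v) τ ↔
    Admissible u τ ∧ Admissible v (run u τ) := by
  induction u generalizing τ with
  | nil => exact ⟨fun h => ⟨h.start, h⟩, fun h => h.2⟩
  | cons c u ih =>
    exact ⟨fun h => ⟨⟨h.1, (ih.1 h.2).1⟩, (ih.1 h.2).2⟩, fun h => ⟨h.1.1, ih.2 ⟨h.1.2, h.2⟩⟩⟩

theorem run_relabel {u : List Bool} (h : Admissible u τ) (e : Equiv.Perm (Fin 7)) :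
    run u (τ.relabel e) = (run u τ).relabel e := by
  induction u generalizing τ with
  | nil => rfl
  | cons c u ih =>
    rw [run, run, move_relabel e h.1.top_ne_nil h.1.bot_ne_nil, ih h.2]

theorem Admissible.relabel {u : List Bool} (h : Admissible u τ) (e : Equiv.Perm (Fin 7)) :
    Admissible u (τ.relabel e) := by
  induction u generalizing τ with
  | nil => exact Returning.relabel h e
  | cons c u ih =>
    refine ⟨h.1.relabel e, ?_⟩
    rw [move_relabel e h.1.top_ne_nil h.1.bot_ne_nil]
    exact ih h.2

theorem descends_path (l : List ℕ) (hd : descends l = true) (hl : ∀ n ∈ l, n ∈ nodes) :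
    ∀ n ∈ l, ∃ u : List Bool, u.length ≤ l.length ∧ Admissible u (decode n) ∧
      ∃ e, run u (decode n) = standard.relabel e := by
  induction l with
  | nil => simp
  | cons m l ih =>
    have hrec : descends (m :: l) = ((Nat.beq m (code standard) ||
      (memb (code ((decode m).move true)) l || memb (code ((decode m).move false)) l)) &&
        descends l) := rfl
    rw [hrec, Bool.and_eq_true, Bool.or_eq_true, Bool.or_eq_true, memb_iff, memb_iff] at hd
    obtain ⟨hm, hd⟩ := hd
    have ih := ih hd fun n hn => hl n (List.mem_cons_of_mem _ hn)
    have hret : (decode m).Returning := ⟨1, m, hl m List.mem_cons_self, (relabel_one _).symm⟩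
    intro n hn
    rcases List.mem_cons.1 hn with rfl | hn
    · have hmove : ∀ c, code ((decode n).move c) ∈ l → ∃ u : List Bool,
          u.length ≤ (n :: l).length ∧ Admissible u (decode n) ∧
            ∃ e, run u (decode n) = standard.relabel e := by
        intro c hc
        obtain ⟨u, hu, hadm, e, he⟩ := ih _ hc
        rcases move_decode (hl n List.mem_cons_self) c with ⟨-, f, hf⟩ | ⟨hnot, -⟩
        · refine ⟨c :: u, by simpa using hu, ⟨hret, ?_⟩, f * e, ?_⟩
          · rw [hf]
            exact hadm.relabel f
          · rw [run, hf, run_relabel hadm, he, relabel_relabel]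
        · exact absurd (hl _ (List.mem_cons_of_mem _ hc)) hnot
      rcases hm with hm | hm | hm
      · refine ⟨[], by simp, hret, 1, ?_⟩
        rw [Nat.eq_of_beq_eq_true hm, decode_code_standard, relabel_one]
        rfl
      · exact hmove _ hm
      · exact hmove _ hm
    · obtain ⟨u, hu, h⟩ := ih n hn
      exact ⟨u, hu.trans (by simp), h⟩

theorem length_nodes_le : nodes.length ≤ 402 := by
  have h := nodes_check
  simp only [Bool.and_eq_true, Nat.ble_eq] at h
  exact h.1.1.2

theorem descends_nodes : descends nodes = true := by
  have h := nodes_check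
  simp only [Bool.and_eq_true] at h
  exact h.1.1.1.2

/-- From every returning exchange there is a path to a renaming of `standard`. -/
theorem Returning.exists_path (hτ : τ.Returning) : ∃ u : List Bool, u.length ≤ 402 ∧
    Admissible u τ ∧ ∃ e, run u τ = standard.relabel e := by
  obtain ⟨f, n, hn, rfl⟩ := hτ
  obtain ⟨u, hu, hadm, e, he⟩ := descends_path nodes descends_nodes (fun _ h => h) n hn
  refine ⟨u, hu.trans length_nodes_le, hadm.relabel f, f * e, ?_⟩
  rw [run_relabel hadm, he, relabel_relabel]


end

/-! ### Weights under splitting -/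

/-- The total width of the top minus the total width of the bottom. -/
def excess (τ : IntervalExchange (Fin 7)) (w : Fin 7 → ℝ) : ℝ :=
  (τ.top.map w).sum - (τ.bot.map w).sum

/-- The nonnegative weights with equal total widths on the top and on the bottom. -/
def cone (τ : IntervalExchange (Fin 7)) : Set (Fin 7 → ℝ) := {w | (∀ a, 0 ≤ w a) ∧ τ.excess w = 0}

/-- The effect of a strict splitting step on the weights. -/
def cut (c : Bool) (τ : IntervalExchange (Fin 7)) : (Fin 7 → ℝ) →ₗ[ℝ] (Fin 7 → ℝ) where
  toFun w := Function.update w (τ.winner c) (w (τ.winner c) - w (τ.loser c))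
  map_add' v w := by
    ext a
    by_cases h : a = τ.winner c
    · subst h; simp; ring
    · simp [h]
  map_smul' r w := by
    ext a
    by_cases h : a = τ.winner c
    · subst h; simp; ring
    · simp [h]

/-- The inverse of `cut`. -/
def paste (c : Bool) (τ : IntervalExchange (Fin 7)) (w : Fin 7 → ℝ) : Fin 7 → ℝ :=
  Function.update w (τ.winner c) (w (τ.winner c) + w (τ.loser c))

section

variable {τ : IntervalExchange (Fin 7)} {c : Bool} {w : Fin 7 → ℝ}

theorem cut_winner : cut c τ w (τ.winner c) = w (τ.winner c) - w (τ.loser c) := by simp [cut]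

theorem cut_of_ne {a : Fin 7} (h : a ≠ τ.winner c) : cut c τ w a = w a := by simp [cut, h]

theorem paste_winner : paste c τ w (τ.winner c) = w (τ.winner c) + w (τ.loser c) := by simp [paste]

theorem paste_of_ne {a : Fin 7} (h : a ≠ τ.winner c) : paste c τ w a = w a := by simp [paste, h]

theorem le_paste (hw : ∀ a, 0 ≤ w a) (a : Fin 7) : w a ≤ paste c τ w a := by
  by_cases h : a = τ.winner c
  · subst h; rw [paste_winner]; linarith [hw (τ.loser c)]
  · rw [paste_of_ne h]

theorem cut_paste (h : τ.loser c ≠ τ.winner c) : cut c τ (paste c τ w) = w := by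
  ext a
  by_cases ha : a = τ.winner c
  · subst ha; rw [cut_winner, paste_winner, paste_of_ne h]; ring
  · rw [cut_of_ne ha, paste_of_ne ha]

theorem paste_cut (h : τ.loser c ≠ τ.winner c) : paste c τ (cut c τ w) = w := by
  ext a
  by_cases ha : a = τ.winner c
  · subst ha; rw [paste_winner, cut_winner, cut_of_ne h]; ring
  · rw [paste_of_ne ha, cut_of_ne ha]

theorem Returning.loser_ne_winner (hτ : τ.Returning) (c : Bool) : τ.loser c ≠ τ.winner c := by
  cases c
  exacts [hτ.lastTop_ne_lastBot, hτ.lastTop_ne_lastBot.symm]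

theorem sum_flatMap_insert (L : List (Fin 7)) (p q x y : Fin 7) (w : Fin 7 → ℝ)
    (h : w p + w q = w x + w y) :
    ((L.flatMap fun z => if z = x then [p, q] else [z]).map w).sum =
      (L.map (Function.update w x (w x + w y))).sum := by
  induction L with
  | nil => simp
  | cons z L ih =>
    rw [List.flatMap_cons, List.map_append, List.sum_append, ih, List.map_cons, List.sum_cons]
    by_cases hz : z = x
    · subst hz; simp [h]
    · simp [hz]

/-- The right end of the base interval moves by the width of the loser, both on the top and on the
bottom. -/
theorem excess_move (hτ : τ.Returning) : (τ.move c).excess w = τ.excess (paste c τ w) := by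
  have hne := hτ.loser_ne_winner c
  have h1 := dropLast_append_lastTop hτ.top_ne_nil
  have h2 := dropLast_append_lastBot hτ.bot_ne_nil
  unfold excess
  conv_rhs => rw [← h1, ← h2]
  cases c
  · rw [move_false]
    simp only [List.map_append, List.sum_append]
    rw [sum_flatMap_insert _ _ _ _ τ.lastTop w (by ring),
      sum_flatMap_insert _ _ _ _ τ.lastTop w (by ring)]
    have hne : τ.lastTop ≠ τ.lastBot := hne
    simp [paste, winner, loser, hne]
    ring
  · rw [move_true]
    simp only [List.map_append, List.sum_append]
    rw [sum_flatMap_insert _ _ _ _ τ.lastBot w (by ring),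
      sum_flatMap_insert _ _ _ _ τ.lastBot w (by ring)]
    have hne : τ.lastBot ≠ τ.lastTop := hne
    simp [paste, winner, loser, hne]
    ring

theorem paste_mem_cone (hτ : τ.Returning) (hw : w ∈ (τ.move c).cone) : paste c τ w ∈ τ.cone :=
  ⟨fun a => (hw.1 a).trans (le_paste hw.1 a), by rw [← excess_move hτ]; exact hw.2⟩

theorem cut_mem_cone (hτ : τ.Returning) :
    cut c τ w ∈ (τ.move c).cone ↔ w ∈ τ.cone ∧ w (τ.loser c) ≤ w (τ.winner c) := by
  have hne := hτ.loser_ne_winner c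
  constructor
  · intro h
    refine ⟨by simpa [paste_cut hne] using paste_mem_cone hτ h, ?_⟩
    have := h.1 (τ.winner c)
    rw [cut_winner] at this
    linarith
  · rintro ⟨h, hle⟩
    refine ⟨fun a => ?_, by rw [excess_move hτ, paste_cut hne]; exact h.2⟩
    by_cases ha : a = τ.winner c
    · subst ha; rw [cut_winner]; linarith
    · rw [cut_of_ne ha]; exact h.1 a

theorem Returning.move_of_pos (hτ : τ.Returning) (hw : w ∈ (τ.move c).cone) (h : ∀ a, 0 < w a) :
    (τ.move c).Returning :=
  (hτ.move_or c).resolve_right fun h' => h' w h (sub_eq_zero.1 hw.2)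

/-- If the exchange at the end of a path carries positive weights, then so do those before. -/
theorem exists_pos_of_run {u : List Bool} {B : ℝ} : ∀ {τ : IntervalExchange (Fin 7)},
    τ.Returning → (∃ v ∈ (run u τ).cone, ∀ a, 1 ≤ v a ∧ v a ≤ B) → Admissible u τ →
      ∃ v ∈ τ.cone, ∀ a, 1 ≤ v a ∧ v a ≤ 2 ^ u.length * B := by
  induction u with
  | nil => exact fun _ h _ => by simpa [run] using h
  | cons c u ih =>
    intro τ hτ hv hadm
    obtain ⟨v, hv, hb⟩ := ih hadm.2.start hv hadm.2
    refine ⟨paste c τ v, paste_mem_cone hτ hv, fun a => ?_⟩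
    refine ⟨(hb a).1.trans (le_paste hv.1 a), ?_⟩
    rw [List.length_cons, pow_succ]
    by_cases ha : a = τ.winner c
    · subst ha; rw [paste_winner]
      linarith [(hb (τ.winner c)).2, (hb (τ.loser c)).2]
    · rw [paste_of_ne ha]
      linarith [(hb a).1, (hb a).2]

theorem excess_relabel (e : Equiv.Perm (Fin 7)) (τ : IntervalExchange (Fin 7)) (w : Fin 7 → ℝ) :
    (τ.relabel e).excess w = τ.excess (w ∘ e) := by
  simp [excess, relabel]

theorem excess_standard (w : Fin 7 → ℝ) :
    standard.excess w = 2 * (w 1 + w 2 + w 3 - w 4 - w 5 - w 6) := by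
  simp [excess, standard]; ring

/-- A bound for weights on returning exchanges that are at least one on every band. -/
def weightBound : ℝ := 2 ^ 402

theorem one_le_weightBound : 1 ≤ weightBound := one_le_pow₀ (by norm_num)

/-- Weights that are at least one and bounded by a constant are obtained from those that are one on
every band of `standard`, by going back along a path to `standard`. -/
theorem Returning.exists_weight (hτ : τ.Returning) :
    ∃ v ∈ τ.cone, ∀ a, 1 ≤ v a ∧ v a ≤ weightBound := by
  obtain ⟨u, hu, hadm, e, he⟩ := hτ.exists_path
  obtain ⟨v, hv, hb⟩ := exists_pos_of_run (B := 1) hτ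
    ⟨fun _ => 1, by rw [he]; exact ⟨by simp, by rw [excess_relabel, excess_standard]; simp⟩,
      by simp⟩ hadm
  refine ⟨v, hv, fun a => ⟨(hb a).1, (hb a).2.trans ?_⟩⟩
  rw [mul_one]
  exact pow_le_pow_right₀ (by norm_num) hu

/-- Equality of the widths of the two rightmost bands is a proper condition. -/
theorem Returning.exists_ends_ne (hτ : τ.Returning) :
    ∃ w, τ.excess w = 0 ∧ w τ.lastTop ≠ w τ.lastBot := by
  obtain ⟨u, hu, hadm, e, he⟩ := hτ.exists_path
  cases u with
  | nil =>
    rw [run] at he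
    subst he
    refine ⟨fun a => if a = e 0 then 1 else 0, ?_, ?_⟩
    · rw [excess_relabel, excess_standard]; simp
    · rw [lastTop_relabel _ (by simp [standard]), lastBot_relabel _ (by simp [standard])]
      simp [standard, lastTop, lastBot]
  | cons c u =>
    obtain ⟨v, hv, hb⟩ := hadm.2.start.exists_weight
    refine ⟨paste c τ v, (paste_mem_cone hτ hv).2, ?_⟩
    have hne := hτ.loser_ne_winner c
    have : paste c τ v (τ.winner c) ≠ paste c τ v (τ.loser c) := by
      rw [paste_winner, paste_of_ne hne]
      linarith [(hb (τ.winner c)).1]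
    cases c
    exacts [this.symm, this]

/-! ### Cylinders -/

/-- The weights for which the first splitting steps are strict and of the prescribed types. -/
def cylinder : List Bool → IntervalExchange (Fin 7) → Set (Fin 7 → ℝ)
  | [], _ => Set.univ
  | c :: u, τ => {w | w (τ.loser c) < w (τ.winner c) ∧ cut c τ w ∈ cylinder u (τ.move c)}

/-- The weights on `τ` whose splitting sequence, up to a certain stage, is strict, and at this stage
is a copy of `standard` that is then split according to `s`. -/
def seen (s : List Bool) (τ : IntervalExchange (Fin 7)) : Set (Fin 7 → ℝ) :=
  {w | ∃ u e, Admissible u τ ∧ run u τ = standard.relabel e ∧ w ∈ cylinder (u ++ s) τ}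

theorem mem_seen_of_cut {s : List Bool} (hτ : τ.Returning) (h : w (τ.loser c) < w (τ.winner c))
    (hw : cut c τ w ∈ seen s (τ.move c)) : w ∈ seen s τ := by
  obtain ⟨u, e, hadm, he, hu⟩ := hw
  exact ⟨c :: u, e, ⟨hτ, hadm⟩, he, h, hu⟩

theorem isOpen_cylinder (u : List Bool) (τ : IntervalExchange (Fin 7)) :
    IsOpen (cylinder u τ) := by
  induction u generalizing τ with
  | nil => exact isOpen_univ
  | cons c u ih =>
    exact (isOpen_lt (continuous_apply (τ.loser c)) (continuous_apply (τ.winner c))).inter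
      ((ih (τ.move c)).preimage (LinearMap.continuous_of_finiteDimensional _))

theorem isOpen_seen (s : List Bool) (τ : IntervalExchange (Fin 7)) : IsOpen (seen s τ) := by
  have : seen s τ = ⋃ u : List Bool, ⋃ _ : ∃ e, Admissible u τ ∧ run u τ = standard.relabel e,
      cylinder (u ++ s) τ := by
    ext w; simp [seen, and_assoc]
  rw [this]
  exact isOpen_iUnion fun u => isOpen_iUnion fun _ => isOpen_cylinder _ _

theorem smul_mem_cylinder {u : List Bool} {r : ℝ} (hr : 0 < r) :
    ∀ {τ : IntervalExchange (Fin 7)} {w : Fin 7 → ℝ}, w ∈ cylinder u τ → r • w ∈ cylinder u τ := by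
  induction u with
  | nil => simp [cylinder]
  | cons c u ih =>
    rintro τ w ⟨h1, h2⟩
    refine ⟨by simpa using mul_lt_mul_of_pos_left h1 hr, ?_⟩
    rw [map_smul]
    exact ih h2

theorem smul_mem_seen {s : List Bool} {r : ℝ} (hr : 0 < r) (h : w ∈ seen s τ) :
    r • w ∈ seen s τ := by
  obtain ⟨u, e, hadm, he, hu⟩ := h
  exact ⟨u, e, hadm, he, smul_mem_cylinder hr hu⟩

theorem cylinder_prefix {u v : List Bool} : ∀ {τ : IntervalExchange (Fin 7)} {w : Fin 7 → ℝ},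
    w ∈ cylinder u τ → w ∈ cylinder v τ → u.length ≤ v.length → u <+: v := by
  induction u generalizing v with
  | nil => simp
  | cons c u ih =>
    rintro τ w ⟨h1, h2⟩ hv hl
    cases v with
    | nil => simp at hl
    | cons d v =>
      obtain ⟨h3, h4⟩ := hv
      have : c = d := by
        cases c <;> cases d <;> first | rfl | exact absurd h1 (not_lt.2 (le_of_lt h3))
      subst this
      exact (List.prefix_cons_inj c).2 (ih h2 h4 (by simpa using hl))

theorem mem_cylinder_of_prefix {u v : List Bool} (h : u <+: v) :
    ∀ {τ : IntervalExchange (Fin 7)} {w : Fin 7 → ℝ}, w ∈ cylinder v τ → w ∈ cylinder u τ := by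
  induction u generalizing v with
  | nil => simp [cylinder]
  | cons c u ih =>
    intro τ w hw
    cases v with
    | nil => simp at h
    | cons d v =>
      rw [List.cons_prefix_cons] at h
      obtain ⟨rfl, h⟩ := h
      exact ⟨hw.1, ih h hw.2⟩

end

/-! ### Charts -/

theorem add_mem_cone {τ : IntervalExchange (Fin 7)} {v w : Fin 7 → ℝ} (hv : v ∈ τ.cone)
    (hw : w ∈ τ.cone) : v + w ∈ τ.cone := by
  refine ⟨fun a => add_nonneg (hv.1 a) (hw.1 a), ?_⟩
  have h1 := hv.2
  have h2 := hw.2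
  simp only [excess, Pi.add_def, List.sum_map_add] at h1 h2 ⊢
  linarith

theorem smul_mem_cone {τ : IntervalExchange (Fin 7)} {r : ℝ} {w : Fin 7 → ℝ} (hr : 0 ≤ r)
    (hw : w ∈ τ.cone) : r • w ∈ τ.cone := by
  refine ⟨fun a => mul_nonneg hr (hw.1 a), ?_⟩
  have h2 := hw.2
  simp only [excess, Pi.smul_def, smul_eq_mul, List.sum_map_mul_left] at h2 ⊢
  rw [← mul_sub, h2, mul_zero]

/-- A stage of the splitting process, seen from a fixed parameter space: `chart` parametrizes the
weights on the exchange `ex`, and `len a` is the length of the band `a`, measured in such a way that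
the total area of the bands is the fixed function `area` of the parameter. -/
structure State (area : (Fin 6 → ℝ) →ₗ[ℝ] ℝ) where
  /-- The exchange. -/
  ex : IntervalExchange (Fin 7)
  /-- The parametrization of the weights. -/
  chart : (Fin 6 → ℝ) →ₗ[ℝ] (Fin 7 → ℝ)
  /-- The lengths of the bands. -/
  len : Fin 7 → ℝ
  returning : ex.Returning
  range_iff : ∀ w, (∃ x, chart x = w) ↔ ex.excess w = 0
  len_pos : ∀ a, 0 < len a
  sum_eq : ∀ x, ∑ a, len a * chart x a = area x
  volume_ne_top : volume {x | chart x ∈ ex.cone ∧ area x ≤ 1} ≠ ∞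

variable {area : (Fin 6 → ℝ) →ₗ[ℝ] ℝ}

/-- The area does not change if the loser `y` gets the length of the winner `x` in addition to its
own, while `x` loses the width of `y`. -/
theorem sum_update_mul (ℓ v : Fin 7 → ℝ) (x y : Fin 7) :
    ∑ a, Function.update ℓ y (ℓ y + ℓ x) a * v a =
      ∑ a, ℓ a * Function.update v x (v x + v y) a := by
  have h1 : ∀ a, Function.update ℓ y (ℓ y + ℓ x) a * v a =
      ℓ a * v a + if a = y then ℓ x * v y else 0 := by
    intro a
    by_cases h : a = y
    · subst h; simp; ring
    · simp [h]
  have h2 : ∀ a, ℓ a * Function.update v x (v x + v y) a =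
      ℓ a * v a + if a = x then ℓ x * v y else 0 := by
    intro a
    by_cases h : a = x
    · subst h; simp; ring
    · simp [h]
  simp only [h1, h2, Finset.sum_add_distrib, Finset.sum_ite_eq', Finset.mem_univ, if_true]

namespace State

/-- The parameters of the weights of area at most one. -/
def region (s : State area) : Set (Fin 6 → ℝ) := {x | s.chart x ∈ s.ex.cone ∧ area x ≤ 1}

theorem mem_child_iff (s : State area) (c : Bool) (x : Fin 6 → ℝ) :
    cut c s.ex (s.chart x) ∈ (s.ex.move c).cone ∧ area x ≤ 1 ↔
      x ∈ s.region ∧ s.chart x (s.ex.loser c) ≤ s.chart x (s.ex.winner c) := by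
  rw [cut_mem_cone s.returning, region, Set.mem_ofPred_eq]
  tauto

/-- The state after a splitting step. -/
def child (s : State area) (c : Bool) (h : (s.ex.move c).Returning) : State area where
  ex := s.ex.move c
  chart := cut c s.ex ∘ₗ s.chart
  len := Function.update s.len (s.ex.loser c) (s.len (s.ex.loser c) + s.len (s.ex.winner c))
  returning := h
  range_iff w := by
    have hne := s.returning.loser_ne_winner c
    rw [excess_move s.returning, ← s.range_iff]
    refine exists_congr fun x => ⟨fun h => ?_, fun h => ?_⟩
    · rw [← h]
      exact (paste_cut hne).symm
    · rw [LinearMap.comp_apply, h, cut_paste hne]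
  len_pos a := by
    by_cases h : a = s.ex.loser c
    · subst h; simpa using add_pos (s.len_pos _) (s.len_pos _)
    · simpa [h] using s.len_pos a
  sum_eq x := by
    rw [sum_update_mul, ← s.sum_eq x]
    exact Finset.sum_congr rfl fun a _ => by
      rw [← congrFun (paste_cut (s.returning.loser_ne_winner c) (w := s.chart x)) a]; rfl
  volume_ne_top := by
    refine ne_top_of_le_ne_top s.volume_ne_top (measure_mono fun x hx => ?_)
    exact ((s.mem_child_iff c x).1 hx).1

theorem mem_region_child {s : State area} {c : Bool} {h : (s.ex.move c).Returning}
    {x : Fin 6 → ℝ} : x ∈ (s.child c h).region ↔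
      x ∈ s.region ∧ s.chart x (s.ex.loser c) ≤ s.chart x (s.ex.winner c) :=
  s.mem_child_iff c x

/-! ### The rates of the bands -/

/-- The least area of a weight that is one on the band `a`. -/
noncomputable def rate (s : State area) (a : Fin 7) : ℝ :=
  sInf ((fun v : Fin 7 → ℝ => ∑ b, s.len b * v b) '' {v | v ∈ s.ex.cone ∧ v a = 1})

theorem dot_nonneg (s : State area) {v : Fin 7 → ℝ} (hv : v ∈ s.ex.cone) :
    0 ≤ ∑ b, s.len b * v b :=
  Finset.sum_nonneg fun b _ => mul_nonneg (s.len_pos b).le (hv.1 b)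

theorem rate_le (s : State area) {v : Fin 7 → ℝ} (hv : v ∈ s.ex.cone) {a : Fin 7} (ha : v a = 1) :
    s.rate a ≤ ∑ b, s.len b * v b :=
  csInf_le ⟨0, by rintro _ ⟨v, hv, rfl⟩; exact s.dot_nonneg hv.1⟩ ⟨v, ⟨hv, ha⟩, rfl⟩

theorem exists_weight_eq_one {τ : IntervalExchange (Fin 7)} (hτ : τ.Returning) (a : Fin 7) :
    ∃ v ∈ τ.cone, v a = 1 ∧ ∀ b, v b ≤ weightBound := by
  obtain ⟨v, hv, hb⟩ := hτ.exists_weight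
  have h0 : 0 < v a := by linarith [(hb a).1]
  refine ⟨(v a)⁻¹ • v, smul_mem_cone (inv_nonneg.2 h0.le) hv, by simp [h0.ne'], fun b => ?_⟩
  have : (v a)⁻¹ ≤ 1 := inv_le_one_of_one_le₀ (hb a).1
  calc (v a)⁻¹ * v b ≤ 1 * v b := mul_le_mul_of_nonneg_right this (hv.1 b)
    _ ≤ _ := by rw [one_mul]; exact (hb b).2

theorem le_rate (s : State area) {a : Fin 7} {r : ℝ}
    (h : ∀ v ∈ s.ex.cone, v a = 1 → r ≤ ∑ b, s.len b * v b) : r ≤ s.rate a := by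
  obtain ⟨v, hv, ha, -⟩ := exists_weight_eq_one s.returning a
  exact le_csInf ⟨_, v, ⟨hv, ha⟩, rfl⟩ (by rintro _ ⟨v, hv, rfl⟩; exact h v hv.1 hv.2)

theorem len_le_rate (s : State area) (a : Fin 7) : s.len a ≤ s.rate a := by
  refine s.le_rate fun v hv ha => ?_
  have := Finset.single_le_sum (f := fun b => s.len b * v b)
    (fun b _ => mul_nonneg (s.len_pos b).le (hv.1 b)) (Finset.mem_univ a)
  simpa [ha] using this

theorem rate_pos (s : State area) (a : Fin 7) : 0 < s.rate a :=
  (s.len_pos a).trans_le (s.len_le_rate a)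

theorem rate_mul_le (s : State area) {v : Fin 7 → ℝ} (hv : v ∈ s.ex.cone) (a : Fin 7) :
    s.rate a * v a ≤ ∑ b, s.len b * v b := by
  rcases (hv.1 a).eq_or_lt with h | h
  · rw [← h, mul_zero]; exact s.dot_nonneg hv
  · have := s.rate_le (smul_mem_cone (inv_nonneg.2 h.le) hv) (a := a) (by simp [h.ne'])
    have h2 : ∑ b, s.len b * ((v a)⁻¹ • v) b = (v a)⁻¹ * ∑ b, s.len b * v b := by
      rw [Finset.mul_sum]
      exact Finset.sum_congr rfl fun b _ => by simp; ring
    rw [h2, inv_mul_eq_div] at this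
    exact (le_div_iff₀ h).1 this

theorem rate_mul_chart_le {s : State area} {x : Fin 6 → ℝ} (hx : x ∈ s.region) (a : Fin 7) :
    s.rate a * s.chart x a ≤ 1 :=
  (s.rate_mul_le hx.1 a).trans ((s.sum_eq x).trans_le hx.2)

variable {s : State area} {c : Bool} (h : (s.ex.move c).Returning)

theorem dot_child (v : Fin 7 → ℝ) : ∑ b, (s.child c h).len b * v b =
    ∑ b, s.len b * paste c s.ex v b := sum_update_mul _ _ _ _

theorem rate_le_rate_child (a : Fin 7) : s.rate a ≤ (s.child c h).rate a := by
  refine le_rate _ fun v hv ha => ?_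
  have hv : v ∈ (s.ex.move c).cone := hv
  rw [dot_child]
  refine le_trans ?_ (s.rate_mul_le (paste_mem_cone s.returning hv) a)
  exact le_mul_of_one_le_right (s.rate_pos a).le (ha ▸ le_paste hv.1 a)

theorem rate_winner_le_rate_child :
    s.rate (s.ex.winner c) ≤ (s.child c h).rate (s.ex.loser c) := by
  refine le_rate _ fun v hv ha => ?_
  have hv : v ∈ (s.ex.move c).cone := hv
  rw [dot_child]
  refine le_trans ?_ (s.rate_mul_le (paste_mem_cone s.returning hv) (s.ex.winner c))
  refine le_mul_of_one_le_right (s.rate_pos _).le ?_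
  rw [paste_winner, ha]
  linarith [hv.1 (s.ex.winner c)]

/-- The factor by which the greatest rate can grow in one step. -/
noncomputable def growth : ℝ := 14 * weightBound

theorem one_le_growth : 1 ≤ growth := by
  rw [growth]; linarith [one_le_weightBound]

theorem dot_le {s : State area} {M W : ℝ} (hM : ∀ a, s.rate a ≤ M) {v : Fin 7 → ℝ}
    (h0 : ∀ a, 0 ≤ v a) (hv : ∀ a, v a ≤ W) : ∑ b, s.len b * v b ≤ 7 * (M * W) := by
  calc ∑ b, s.len b * v b ≤ ∑ _b : Fin 7, M * W := Finset.sum_le_sum fun b _ =>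
        mul_le_mul ((s.len_le_rate b).trans (hM b)) (hv b) (h0 b)
          ((s.rate_pos b).le.trans (hM b))
    _ = 7 * (M * W) := by simp

theorem paste_le {τ : IntervalExchange (Fin 7)} {v : Fin 7 → ℝ} {W : ℝ} (h0 : ∀ a, 0 ≤ v a)
    (hv : ∀ a, v a ≤ W) (a : Fin 7) : paste c τ v a ≤ 2 * W := by
  by_cases ha : a = τ.winner c
  · subst ha; rw [paste_winner]; linarith [hv (τ.winner c), hv (τ.loser c)]
  · rw [paste_of_ne ha]; linarith [hv a, h0 a]

theorem rate_child_le {M : ℝ} (hM : ∀ a, s.rate a ≤ M) (a : Fin 7) :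
    (s.child c h).rate a ≤ growth * M := by
  obtain ⟨v, hv, ha, hb⟩ := exists_weight_eq_one h a
  refine ((s.child c h).rate_le hv ha).trans ?_
  rw [dot_child]
  refine (dot_le hM (fun b => (hv.1 b).trans (le_paste hv.1 b)) (paste_le hv.1 hb)).trans_eq ?_
  rw [growth]; ring

/-! ### Homotheties -/

/-- A set `A` that is mapped into `B` by a homothety of ratio `r⁻¹` is at most `r ^ 6` times as
large. -/
theorem volume_le_of_homothety {A B : Set (Fin 6 → ℝ)} (v : Fin 6 → ℝ) {r : ℝ} (hr : 0 < r)
    (hAB : ∀ p ∈ A, r⁻¹ • p + (1 - r⁻¹) • v ∈ B) :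
    volume A ≤ ENNReal.ofReal (r ^ 6) * volume B := by
  have h1 : AffineMap.homothety v r⁻¹ '' A ⊆ B := by
    rintro _ ⟨p, hp, rfl⟩
    convert hAB p hp using 1
    simp only [AffineMap.homothety_apply, vsub_eq_sub, vadd_eq_add, smul_sub, sub_smul, one_smul]
    abel
  have h2 := Measure.addHaar_image_homothety volume v r⁻¹ A
  rw [Module.finrank_fin_fun, inv_pow, abs_of_pos (by positivity)] at h2
  have h3 : volume A = ENNReal.ofReal (r ^ 6) * (ENNReal.ofReal (r ^ 6)⁻¹ * volume A) := by
    rw [← mul_assoc, ← ENNReal.ofReal_mul (by positivity), mul_inv_cancel₀ (by positivity)]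
    simp
  rw [h3, ← h2]
  exact mul_le_mul_right (measure_mono h1) _

theorem combination_mem_region {s : State area} {p v : Fin 6 → ℝ} (hp : p ∈ s.region)
    (hv : v ∈ s.region) {r : ℝ} (hr : 1 ≤ r) : r⁻¹ • p + (1 - r⁻¹) • v ∈ s.region := by
  have h1 : 0 ≤ r⁻¹ := by positivity
  have h2 : 0 ≤ 1 - r⁻¹ := sub_nonneg.2 (inv_le_one_of_one_le₀ hr)
  refine ⟨?_, ?_⟩
  · rw [map_add, map_smul, map_smul]
    exact add_mem_cone (smul_mem_cone h1 hp.1) (smul_mem_cone h2 hv.1)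
  · rw [map_add, map_smul, map_smul, smul_eq_mul, smul_eq_mul]
    nlinarith [hp.2, hv.2]

/-- A weight with moderate entries, scaled down, is represented in the region. -/
theorem exists_mem_region {s : State area} {M : ℝ} (hM : ∀ a, s.rate a ≤ M) {v : Fin 7 → ℝ}
    (hv : v ∈ s.ex.cone) (hb : ∀ a, v a ≤ 2 * weightBound) :
    ∃ x ∈ s.region, s.chart x = (growth * M)⁻¹ • v := by
  have hM0 : 0 < M := (s.rate_pos 0).trans_le (hM 0)
  have hg : 0 < growth * M := mul_pos (by linarith [one_le_growth]) hM0
  have hmem := smul_mem_cone (inv_nonneg.2 hg.le) hv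
  obtain ⟨x, hx⟩ := (s.range_iff _).2 hmem.2
  refine ⟨x, ⟨hx ▸ hmem, ?_⟩, hx⟩
  rw [← s.sum_eq, hx]
  have h2 : ∑ b, s.len b * ((growth * M)⁻¹ • v) b = (growth * M)⁻¹ * ∑ b, s.len b * v b := by
    rw [Finset.mul_sum]
    exact Finset.sum_congr rfl fun b _ => by simp; ring
  rw [h2, inv_mul_le_one₀ hg]
  refine (dot_le hM hv.1 hb).trans_eq ?_
  rw [growth]; ring

/-- A splitting step in which the loser has a comparatively large rate has a probability that is
bounded below. -/
theorem volume_le_child {M K : ℝ} (hM : ∀ a, s.rate a ≤ M) (hK0 : 0 ≤ K)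
    (hK : M ≤ K * s.rate (s.ex.loser c)) :
    volume s.region ≤ ENNReal.ofReal ((1 + growth * K) ^ 6) * volume (s.child c h).region := by
  have hM0 : 0 < M := (s.rate_pos 0).trans_le (hM 0)
  have hg : 0 < growth := by linarith [one_le_growth]
  obtain ⟨v, hv, hb⟩ := h.exists_weight
  obtain ⟨x, hx, hxv⟩ := exists_mem_region hM (paste_mem_cone s.returning hv)
    (paste_le hv.1 fun a => (hb a).2)
  have hr : 1 ≤ 1 + growth * K := by nlinarith
  refine volume_le_of_homothety x (by linarith) fun p hp => ?_
  rw [mem_region_child]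
  refine ⟨combination_mem_region hp hx hr, ?_⟩
  have hne := s.returning.loser_ne_winner c
  have h1 : s.chart x (s.ex.winner c) - s.chart x (s.ex.loser c) ≥ (growth * M)⁻¹ := by
    rw [hxv, Pi.smul_apply, Pi.smul_apply, paste_winner, paste_of_ne hne, ← smul_sub]
    have := (hb (s.ex.winner c)).1
    have h0 : 0 < (growth * M)⁻¹ := by positivity
    simp only [smul_eq_mul]
    nlinarith
  have h2 : M * s.chart p (s.ex.loser c) ≤ K := by
    have h3 := rate_mul_chart_le hp (s.ex.loser c)
    have h4 := hp.1.1 (s.ex.loser c)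
    calc M * s.chart p (s.ex.loser c) ≤ K * s.rate (s.ex.loser c) * s.chart p (s.ex.loser c) :=
          mul_le_mul_of_nonneg_right hK h4
      _ = K * (s.rate (s.ex.loser c) * s.chart p (s.ex.loser c)) := by ring
      _ ≤ K * 1 := mul_le_mul_of_nonneg_left h3 hK0
      _ = K := mul_one K
  have h5 := hp.1.1 (s.ex.winner c)
  rw [map_add, map_smul, map_smul]
  simp only [Pi.add_apply, Pi.smul_apply, smul_eq_mul]
  have h6 : 1 - (1 + growth * K)⁻¹ = (1 + growth * K)⁻¹ * (growth * K) := by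
    field_simp; ring
  rw [h6]
  have h7 : s.chart p (s.ex.loser c) ≤ s.chart p (s.ex.winner c) +
      growth * K * (s.chart x (s.ex.winner c) - s.chart x (s.ex.loser c)) := by
    have h8 : growth * K * (growth * M)⁻¹ = K / M := by field_simp
    have h9 : s.chart p (s.ex.loser c) ≤ K / M := by
      rw [le_div_iff₀ hM0]; linarith
    have h10 := mul_le_mul_of_nonneg_left h1 (mul_nonneg hg.le hK0)
    linarith
  have h11 := mul_le_mul_of_nonneg_left h7 (inv_nonneg.2 (by linarith : 0 ≤ 1 + growth * K))
  linarith

/-- The weights that are not too small on any band make up a definite part of the region. -/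
theorem volume_le_wide {s : State area} {M : ℝ} (hM : ∀ a, s.rate a ≤ M) :
    volume s.region ≤ ENNReal.ofReal (2 ^ 6) *
      volume {x | x ∈ s.region ∧ ∀ a, (2 * growth * M)⁻¹ ≤ s.chart x a} := by
  have hM0 : 0 < M := (s.rate_pos 0).trans_le (hM 0)
  have hg : 0 < growth := by linarith [one_le_growth]
  obtain ⟨v, hv, hb⟩ := s.returning.exists_weight
  obtain ⟨x, hx, hxv⟩ := exists_mem_region hM hv
    (fun a => (hb a).2.trans (by linarith [one_le_weightBound]))
  refine volume_le_of_homothety x (by norm_num) fun p hp =>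
    ⟨combination_mem_region hp hx (by norm_num), fun a => ?_⟩
  rw [map_add, map_smul, map_smul, hxv]
  simp only [Pi.add_apply, Pi.smul_apply, smul_eq_mul]
  have h1 := hp.1.1 a
  have h2 : (2 * growth * M)⁻¹ = 2⁻¹ * (growth * M)⁻¹ := by rw [mul_assoc, mul_inv]
  have h3 : 0 < (growth * M)⁻¹ := by positivity
  have h4 : (growth * M)⁻¹ ≤ (growth * M)⁻¹ * v a := le_mul_of_one_le_right h3.le (hb a).1
  rw [h2]
  linarith

/-! ### Decomposition along the first step -/

theorem volume_setOf_eq_zero (f : (Fin 6 → ℝ) →ₗ[ℝ] ℝ) (hf : ∃ x, f x ≠ 0) :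
    volume {x | f x = 0} = 0 := by
  refine Measure.addHaar_submodule volume (LinearMap.ker f) fun htop => ?_
  obtain ⟨x, hx⟩ := hf
  exact hx (LinearMap.mem_ker.1 (htop ▸ Submodule.mem_top))

theorem volume_chart_eq_zero (s : State area) (a : Fin 7) : volume {x | s.chart x a = 0} = 0 := by
  refine volume_setOf_eq_zero (LinearMap.proj a ∘ₗ s.chart) ?_
  obtain ⟨v, hv, hb⟩ := s.returning.exists_weight
  obtain ⟨x, rfl⟩ := (s.range_iff v).2 hv.2
  exact ⟨x, (one_pos.trans_le (hb a).1).ne'⟩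

/-- The parameters of the weights for which the first step is strict and of type `c`. -/
def strict (s : State area) (c : Bool) : Set (Fin 6 → ℝ) :=
  {x | s.chart x (s.ex.loser c) < s.chart x (s.ex.winner c)}

theorem measurableSet_strict (s : State area) (c : Bool) : MeasurableSet (s.strict c) := by
  have h : Continuous s.chart := LinearMap.continuous_of_finiteDimensional _
  exact (isOpen_lt ((continuous_apply (s.ex.loser c)).comp h)
    ((continuous_apply (s.ex.winner c)).comp h)).measurableSet

/-- An inequality between volumes can be checked separately on the two types of first steps. The
parameters of ties, and those of steps to exchanges that are not returning, form a null set. -/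
theorem volume_le_of_children (s : State area) {X Y : Set (Fin 6 → ℝ)} (C : ℝ≥0∞)
    (hX : X ⊆ s.region) (hXY : ∀ c, (s.ex.move c).Returning →
      volume (X ∩ s.strict c) ≤ C * volume (Y ∩ s.strict c)) : volume X ≤ C * volume Y := by
  have hXY' : ∀ c, volume (X ∩ s.strict c) ≤ C * volume (Y ∩ s.strict c) := by
    intro c
    by_cases h : (s.ex.move c).Returning
    · exact hXY c h
    · refine le_of_eq_of_le (measure_mono_null ?_ (measure_iUnion_null fun a : Fin 7 =>
        s.volume_chart_eq_zero a)) zero_le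
      rintro x ⟨hx, hs⟩
      by_contra hcon
      simp only [Set.mem_iUnion, Set.mem_ofPred_eq, not_exists] at hcon
      have hpos : ∀ a, 0 < s.chart x a := fun a =>
        lt_of_le_of_ne ((hX hx).1.1 a) (Ne.symm (hcon a))
      refine h (s.returning.move_of_pos
        ((cut_mem_cone s.returning).2 ⟨(hX hx).1, le_of_lt hs⟩) fun a => ?_)
      by_cases ha : a = s.ex.winner c
      · subst ha; rw [cut_winner]; exact sub_pos.2 hs
      · rw [cut_of_ne ha]; exact hpos a
  have hnull : volume {x | s.chart x s.ex.lastTop = s.chart x s.ex.lastBot} = 0 := by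
    have := volume_setOf_eq_zero
      (LinearMap.proj s.ex.lastTop ∘ₗ s.chart - LinearMap.proj s.ex.lastBot ∘ₗ s.chart) (by
        obtain ⟨w, hw, hne⟩ := s.returning.exists_ends_ne
        obtain ⟨x, rfl⟩ := (s.range_iff w).2 hw
        exact ⟨x, by simpa [sub_eq_zero] using hne⟩)
    simpa [sub_eq_zero] using this
  have hcover : X ⊆ (X ∩ s.strict true ∪ X ∩ s.strict false) ∪
      {x | s.chart x s.ex.lastTop = s.chart x s.ex.lastBot} := by
    intro x hx
    rcases lt_trichotomy (s.chart x s.ex.lastTop) (s.chart x s.ex.lastBot) with h | h | h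
    · exact .inl (.inr ⟨hx, h⟩)
    · exact .inr h
    · exact .inl (.inl ⟨hx, h⟩)
  have hdisj : Y ∩ s.strict false ⊆ Y \ s.strict true := fun x hx =>
    ⟨hx.1, fun h => lt_asymm (show s.chart x s.ex.lastBot < s.chart x s.ex.lastTop from h) hx.2⟩
  calc volume X ≤ volume (X ∩ s.strict true) + volume (X ∩ s.strict false) + 0 := by
        rw [← hnull]
        exact (measure_mono hcover).trans ((measure_union_le _ _).trans
          (add_le_add_left (measure_union_le _ _) _))
    _ ≤ C * volume (Y ∩ s.strict true) + C * volume (Y ∩ s.strict false) := by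
        rw [add_zero]
        exact add_le_add (hXY' true) (hXY' false)
    _ = C * (volume (Y ∩ s.strict true) + volume (Y ∩ s.strict false)) := by rw [mul_add]
    _ ≤ C * volume Y := by
        rw [← measure_inter_add_sdiff Y (s.measurableSet_strict true)]
        gcongr

/-- Up to a null set, the region of a child consists of parameters of strict first steps. -/
theorem volume_le_inter_strict {X Y : Set (Fin 6 → ℝ)} (hX : X ⊆ (s.child c h).region)
    (hXY : X ∩ s.strict c ⊆ Y) : volume X ≤ volume (Y ∩ s.strict c) := by
  have hnull := (s.child c h).volume_chart_eq_zero (s.ex.winner c)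
  rw [← add_zero (volume (Y ∩ s.strict c)), ← hnull]
  refine (measure_mono fun x hx => ?_).trans (measure_union_le _ _)
  rcases (mem_region_child.1 (hX hx)).2.lt_or_eq with hlt | heq
  · exact .inl ⟨hXY ⟨hx, hlt⟩, hlt⟩
  · refine .inr ?_
    change cut c s.ex (s.chart x) (s.ex.winner c) = 0
    rw [cut_winner, heq, sub_self]

end State

/-! ### A tour of the rightmost bands -/

theorem admissible_of_mem_cylinder {u : List Bool} : ∀ {τ : IntervalExchange (Fin 7)}
    {w : Fin 7 → ℝ}, τ.Returning → w ∈ τ.cone → (∀ a, 0 < w a) → w ∈ cylinder u τ →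
      Admissible u τ := by
  induction u with
  | nil => exact fun h _ _ _ => h
  | cons c u ih =>
    rintro τ w hτ hw hpos ⟨h1, h2⟩
    have hcone := (cut_mem_cone hτ).2 ⟨hw, le_of_lt h1⟩
    have hpos' : ∀ a, 0 < cut c τ w a := by
      intro a
      by_cases ha : a = τ.winner c
      · subst ha; rw [cut_winner]; linarith
      · rw [cut_of_ne ha]; exact hpos a
    exact ⟨hτ, ih (hτ.move_of_pos hcone hpos') hcone hpos' h2⟩

/-- A path from `standard` along which each band becomes rightmost at some time. -/
def tour : List Bool := [true, true, true, false, false]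

theorem admissible_tour : Admissible tour standard := by
  refine admissible_of_mem_cylinder (w := ![1, 4, 4, 4, 10, 1, 1]) standard_returning ⟨?_, ?_⟩ ?_ ?_
  · intro a; fin_cases a <;> simp
  · rw [excess_standard]; simp; norm_num
  · intro a; fin_cases a <;> simp
  · simp [tour, cylinder, cut, move, winner, loser, lastTop, lastBot, standard, Function.update]
    norm_num

theorem exists_take_tour : ∀ a, ∃ k : Fin 6, ∃ c, (run (tour.take k) standard).winner c = a := by
  decide

theorem Returning.exists_path_to {τ : IntervalExchange (Fin 7)} (hτ : τ.Returning) (b : Fin 7) :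
    ∃ u : List Bool, u.length ≤ 407 ∧ Admissible u τ ∧ ∃ c, (run u τ).winner c = b := by
  obtain ⟨u, hu, hadm, e, he⟩ := hτ.exists_path
  obtain ⟨k, c, hk⟩ := exists_take_tour (e⁻¹ b)
  have h1 : Admissible (tour.take k) standard := by
    have := admissible_tour
    rw [← List.take_append_drop k tour, admissible_append] at this
    exact this.1
  refine ⟨u ++ tour.take k, ?_, admissible_append.2 ⟨hadm, he ▸ h1.relabel e⟩, c, ?_⟩
  · rw [List.length_append]
    have : (tour.take k).length ≤ 5 := by simp [tour]
    omega
  · rw [run_append, he, run_relabel h1]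
    have h2 := h1.run
    have : ∀ e : Equiv.Perm (Fin 7), ((run (tour.take k) standard).relabel e).winner c =
        e ((run (tour.take k) standard).winner c) := fun e => by
      cases c
      exacts [lastBot_relabel e h2.bot_ne_nil, lastTop_relabel e h2.top_ne_nil]
    rw [this, hk]
    simp

theorem winner_not (τ : IntervalExchange (Fin 7)) (c : Bool) : τ.winner (!c) = τ.loser c := by
  cases c <;> rfl

theorem winner_move (τ : IntervalExchange (Fin 7)) (c : Bool) :
    (τ.move c).winner c = τ.winner c := by
  cases c
  · simp [winner, move_false, lastBot]
  · simp [winner, move_true, lastTop]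

namespace State

/-! ### Uniform lower bounds for probabilities -/

/-- The parameters of the weights that are seen to follow `w`. -/
def hits (s : State area) (w : List Bool) : Set (Fin 6 → ℝ) := {x | s.chart x ∈ seen w s.ex}

theorem measurableSet_hits (s : State area) (w : List Bool) : MeasurableSet (s.hits w) :=
  ((isOpen_seen w s.ex).preimage (LinearMap.continuous_of_finiteDimensional s.chart)).measurableSet

theorem volume_child_hits_le {s : State area} {c : Bool} (h : (s.ex.move c).Returning)
    (w : List Bool) : volume ((s.child c h).region ∩ (s.child c h).hits w) ≤
      volume (s.region ∩ s.hits w ∩ s.strict c) :=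
  volume_le_inter_strict h Set.inter_subset_left fun _ hx =>
    ⟨(mem_region_child.1 hx.1.1).1, mem_seen_of_cut s.returning hx.2 hx.1.2⟩

/-- If the rates are comparable, then any path of a given length has a probability that is bounded
below. -/
theorem exists_volume_le_cylinder (n : ℕ) : ∀ K : ℝ, 1 ≤ K → ∃ C : ℝ≥0∞, C ≠ ∞ ∧
    ∀ (s : State area) (M : ℝ) (u : List Bool), (∀ a, s.rate a ≤ M) → (∀ a, M ≤ K * s.rate a) →
      u.length ≤ n → Admissible u s.ex →
        volume s.region ≤ C * volume (s.region ∩ {x | s.chart x ∈ cylinder u s.ex}) := by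
  induction n with
  | zero =>
    refine fun K _ => ⟨1, ENNReal.one_ne_top, fun s M u _ _ hu _ => ?_⟩
    rw [List.length_eq_zero_iff.1 (Nat.le_zero.1 hu)]
    simp [cylinder]
  | succ n ih =>
    intro K hK
    have hg := one_le_growth
    obtain ⟨C, hC, h⟩ := ih (growth * K) (by nlinarith)
    refine ⟨1 + ENNReal.ofReal ((1 + growth * K) ^ 6) * C,
      ENNReal.add_ne_top.2 ⟨ENNReal.one_ne_top, ENNReal.mul_ne_top ENNReal.ofReal_ne_top hC⟩,
      fun s M u hM hKM hu hadm => ?_⟩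
    cases u with
    | nil =>
      simp only [cylinder, Set.mem_univ, Set.ofPred_true, Set.inter_univ]
      exact le_mul_of_one_le_left' le_self_add
    | cons c u =>
      have hc := hadm.2.start
      have h1 := volume_le_child hc hM (by linarith) (hKM _)
      have h2 := h (s.child c hc) (growth * M) u (rate_child_le hc hM) (fun a => by
        have := rate_le_rate_child hc a
        calc growth * M ≤ growth * (K * s.rate a) :=
              mul_le_mul_of_nonneg_left (hKM a) (by linarith)
          _ = growth * K * s.rate a := by ring
          _ ≤ _ := mul_le_mul_of_nonneg_left this (by nlinarith)) (by simpa using hu) hadm.2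
      have h3 : volume ((s.child c hc).region ∩
          {x | (s.child c hc).chart x ∈ cylinder u (s.child c hc).ex}) ≤
          volume (s.region ∩ {x | s.chart x ∈ cylinder (c :: u) s.ex} ∩ s.strict c) :=
        volume_le_inter_strict hc Set.inter_subset_left fun x hx =>
          ⟨(mem_region_child.1 hx.1.1).1, hx.2, hx.1.2⟩
      calc volume s.region
          ≤ ENNReal.ofReal ((1 + growth * K) ^ 6) *
            (C * volume (s.region ∩ {x | s.chart x ∈ cylinder (c :: u) s.ex})) := by
            refine h1.trans (mul_le_mul_right (h2.trans (mul_le_mul_right ?_ _)) _)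
            exact h3.trans (measure_mono Set.inter_subset_left)
        _ ≤ _ := by
            rw [← mul_assoc]
            gcongr
            exact le_add_self

/-- If `j` bands have rates that are comparable with the greatest one, then the probability to see
`w` is bounded below. -/
def Bound (area : (Fin 6 → ℝ) →ₗ[ℝ] ℝ) (w : List Bool) (j : ℕ) : Prop :=
  ∀ K : ℝ, 1 ≤ K → ∃ C : ℝ≥0∞, C ≠ ∞ ∧ ∀ (s : State area) (M : ℝ) (A : Finset (Fin 7)),
    (∀ a, s.rate a ≤ M) → j ≤ A.card → (∀ a ∈ A, M ≤ K * s.rate a) →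
      volume s.region ≤ C * volume (s.region ∩ s.hits w)

theorem bound_seven {w : List Bool} (hw : Admissible w standard) : Bound area w 7 := by
  intro K hK
  obtain ⟨C, hC, h⟩ := exists_volume_le_cylinder (area := area) (402 + w.length) K hK
  refine ⟨C, hC, fun s M A hM hA hKM => ?_⟩
  have hA : A = Finset.univ := by
    rw [← Finset.card_eq_iff_eq_univ]
    exact le_antisymm (Finset.card_le_univ A) hA
  subst hA
  obtain ⟨u, hu, hadm, e, he⟩ := s.returning.exists_path
  refine (h s M (u ++ w) hM (fun a => hKM a (Finset.mem_univ a))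
    (by rw [List.length_append]; omega)
    (admissible_append.2 ⟨hadm, he ▸ hw.relabel e⟩)).trans ?_
  gcongr
  exact fun x hx => ⟨u, e, hadm, he, hx⟩


/-- As long as the bands outside of `A` win, one of them stays at the right end. So the splitting
goes on until the rate of one of these bands has become comparable with the rates in `A`. -/
theorem volume_wide_le {w : List Bool} {A : Finset (Fin 7)} {K M δ : ℝ} {C : ℝ≥0∞} (hK : 1 ≤ K)
    (hM : 0 < M)
    (hC : ∀ (s : State area) (b : Fin 7), b ∉ A → (∀ a, s.rate a ≤ 2 * growth ^ 2 * M) →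
      (∀ a ∈ insert b A, M ≤ K * s.rate a) → volume s.region ≤ C * volume (s.region ∩ s.hits w))
    (n : ℕ) : ∀ s : State area, (∃ c, s.ex.winner c ∉ A) → (∀ a ∈ A, M ≤ K * s.rate a) →
      (∀ a ∉ A, s.rate a ≤ M) → (∀ a, δ ≤ s.len a) →
      14 * growth * M < ∑ a, s.len a + n * δ →
        volume {x | x ∈ s.region ∧ ∀ a ∈ A, (2 * growth * M)⁻¹ ≤ s.chart x a} ≤
          C * volume (s.region ∩ s.hits w) := by
  have hg := one_le_growth
  have hgM : 0 < 2 * growth * M := by positivity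
  have hrates : ∀ s : State area, (∀ a ∉ A, s.rate a ≤ M) → ∀ x ∈ s.region,
      (∀ a ∈ A, (2 * growth * M)⁻¹ ≤ s.chart x a) → ∀ a, s.rate a ≤ 2 * growth * M := by
    intro s hnot x hx hxA a
    by_cases ha : a ∈ A
    · have h1 := rate_mul_chart_le hx a
      have h2 := mul_le_mul_of_nonneg_left (hxA a ha) (s.rate_pos a).le
      have h3 : s.rate a * (2 * growth * M)⁻¹ ≤ 1 := h2.trans h1
      rwa [← div_eq_mul_inv, div_le_one₀ hgM] at h3
    · exact (hnot a ha).trans (by nlinarith)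
  induction n with
  | zero =>
    intro s _ _ hnot _ hlen
    suffices h : {x | x ∈ s.region ∧ ∀ a ∈ A, (2 * growth * M)⁻¹ ≤ s.chart x a} = ∅ by
      rw [h, measure_empty]; exact zero_le
    rw [Set.eq_empty_iff_forall_notMem]
    rintro x ⟨hx, hxA⟩
    have h1 : ∑ a, s.len a ≤ ∑ _a : Fin 7, 2 * growth * M := Finset.sum_le_sum fun a _ =>
      (s.len_le_rate a).trans (hrates s hnot x hx hxA a)
    simp only [Finset.sum_const, Finset.card_univ, Fintype.card_fin, nsmul_eq_mul] at h1
    push_cast at h1 hlen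
    linarith
  | succ n ih =>
    intro s hend hA hnot hδ hlen
    rcases Set.eq_empty_or_nonempty
      {x | x ∈ s.region ∧ ∀ a ∈ A, (2 * growth * M)⁻¹ ≤ s.chart x a} with hemp | ⟨x₀, hx₀, hx₀A⟩
    · rw [hemp, measure_empty]; exact zero_le
    have hr := hrates s hnot x₀ hx₀ hx₀A
    refine s.volume_le_of_children C (fun x hx => hx.1) fun c hc => ?_
    refine le_trans ?_ (mul_le_mul_right (volume_child_hits_le hc w) C)
    have hsub : {x | x ∈ s.region ∧ ∀ a ∈ A, (2 * growth * M)⁻¹ ≤ s.chart x a} ∩ s.strict c ⊆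
        (s.child c hc).region := fun x hx => mem_region_child.2 ⟨hx.1.1, le_of_lt hx.2⟩
    have hA' : ∀ a ∈ A, M ≤ K * (s.child c hc).rate a := fun a ha =>
      (hA a ha).trans (mul_le_mul_of_nonneg_left (rate_le_rate_child hc a) (by linarith))
    by_cases hex : ∃ b ∉ A, M ≤ K * (s.child c hc).rate b
    · obtain ⟨b, hb, hbM⟩ := hex
      refine (measure_mono hsub).trans (hC _ b hb (fun a => ?_) ?_)
      · exact (rate_child_le hc hr a).trans_eq (by ring)
      · intro a ha
        rcases Finset.mem_insert.1 ha with rfl | ha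
        exacts [hbM, hA' a ha]
    · push Not at hex
      have hnot' : ∀ a ∉ A, (s.child c hc).rate a ≤ M := fun a ha =>
        (le_mul_of_one_le_left ((s.child c hc).rate_pos a).le hK).trans (hex a ha).le
      -- A band of `A` that beats a band outside of `A` would raise the rate of the latter.
      have hwin : s.ex.winner c ∉ A := by
        intro hwA
        obtain ⟨d, hd⟩ := hend
        have hdc : d = !c := by
          cases c <;> cases d <;> first | rfl | exact absurd hwA hd
        rw [hdc, winner_not] at hd
        refine absurd (hex _ hd) (not_lt.2 ((hA _ hwA).trans ?_))
        exact mul_le_mul_of_nonneg_left (rate_winner_le_rate_child hc) (by linarith)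
      refine le_trans (measure_mono ?_) (ih (s.child c hc) ⟨c, ?_⟩ hA' hnot' (fun a => ?_) ?_)
      · refine fun x hx => ⟨hsub hx, fun a ha => ?_⟩
        have hne : a ≠ s.ex.winner c := fun h => hwin (h ▸ ha)
        refine (hx.1.2 a ha).trans_eq ?_
        exact (cut_of_ne hne).symm
      · exact (winner_move s.ex c).symm ▸ hwin
      · refine (hδ a).trans ?_
        by_cases ha : a = s.ex.loser c
        · subst ha
          simpa [child] using (s.len_pos (s.ex.winner c)).le
        · simp [child, ha]
      · have h2 : ∑ a, (s.child c hc).len a = ∑ a, s.len a + s.len (s.ex.winner c) := by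
          have h3 : ∀ a, (s.child c hc).len a =
              s.len a + if a = s.ex.loser c then s.len (s.ex.winner c) else 0 := by
            intro a
            by_cases ha : a = s.ex.loser c
            · subst ha; simp [child]
            · simp [child, ha]
          simp only [h3, Finset.sum_add_distrib, Finset.sum_ite_eq', Finset.mem_univ, if_true]
        rw [h2]
        push_cast at hlen
        linarith [hδ (s.ex.winner c)]

/-- The bands of `A` compete with one another until another band gets to the right end. -/
theorem exists_volume_le_of_path {w : List Bool} {j : ℕ} (hj : Bound area w (j + 1)) (n : ℕ) :
    ∀ K : ℝ, 1 ≤ K → ∃ C : ℝ≥0∞, C ≠ ∞ ∧ ∀ (s : State area) (M : ℝ) (A : Finset (Fin 7)),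
      (∀ a, s.rate a ≤ M) → j ≤ A.card → (∀ a ∈ A, M ≤ K * s.rate a) →
        (∃ u : List Bool, u.length ≤ n ∧ Admissible u s.ex ∧ ∃ c, (run u s.ex).winner c ∉ A) →
          volume s.region ≤ C * volume (s.region ∩ s.hits w) := by
  have hg := one_le_growth
  have hfinish : ∀ K : ℝ, 1 ≤ K → ∃ C : ℝ≥0∞, C ≠ ∞ ∧
      ∀ (s : State area) (M : ℝ) (A : Finset (Fin 7)), (∀ a, s.rate a ≤ M) → j ≤ A.card →
        (∀ a ∈ A, M ≤ K * s.rate a) → (∃ c, s.ex.winner c ∉ A) →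
          volume s.region ≤ C * volume (s.region ∩ s.hits w) := by
    intro K hK
    have hg2 : 1 ≤ 2 * growth ^ 2 := by nlinarith
    obtain ⟨C, hC, h⟩ := hj (2 * growth ^ 2 * K) (by nlinarith)
    refine ⟨ENNReal.ofReal (2 ^ 6) * C, ENNReal.mul_ne_top ENNReal.ofReal_ne_top hC, ?_⟩
    intro s M A hM hA hKM hend
    have hM0 : 0 < M := (s.rate_pos 0).trans_le (hM 0)
    obtain ⟨a₀, -, ha₀⟩ := Finset.exists_min_image Finset.univ s.len ⟨0, Finset.mem_univ 0⟩
    obtain ⟨n, hn⟩ := exists_nat_gt ((14 * growth * M) / s.len a₀)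
    rw [div_lt_iff₀ (s.len_pos a₀)] at hn
    refine (volume_le_wide hM).trans ?_
    rw [mul_assoc (ENNReal.ofReal _)]
    refine mul_le_mul_right (le_trans (measure_mono ?_) (volume_wide_le (A := A) (δ := s.len a₀)
      hK hM0 ?_ n s hend hKM (fun a _ => hM a) (fun a => ha₀ a (Finset.mem_univ a)) ?_)) _
    · exact fun x hx => ⟨hx.1, fun a _ => hx.2 a⟩
    · intro s b hb hs hbA
      refine h s _ (insert b A) hs (by rw [Finset.card_insert_of_notMem hb]; omega) fun a ha => ?_
      rw [mul_assoc _ K]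
      exact mul_le_mul_of_nonneg_left (hbA a ha) (by positivity)
    · have := Finset.sum_nonneg fun a (_ : a ∈ Finset.univ) => (s.len_pos a).le
      linarith
  induction n with
  | zero =>
    intro K hK
    obtain ⟨C, hC, h⟩ := hfinish K hK
    refine ⟨C, hC, fun s M A hM hA hKM hu => h s M A hM hA hKM ?_⟩
    obtain ⟨u, hu, -, hc⟩ := hu
    rwa [List.length_eq_zero_iff.1 (Nat.le_zero.1 hu)] at hc
  | succ n ih =>
    intro K hK
    obtain ⟨C, hC, h⟩ := hfinish K hK
    obtain ⟨C', hC', h'⟩ := ih (growth * K) (by nlinarith)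
    refine ⟨C + ENNReal.ofReal ((1 + growth * K) ^ 6) * C',
      ENNReal.add_ne_top.2 ⟨hC, ENNReal.mul_ne_top ENNReal.ofReal_ne_top hC'⟩, ?_⟩
    intro s M A hM hA hKM hu
    by_cases hend : ∃ c, s.ex.winner c ∉ A
    · exact (h s M A hM hA hKM hend).trans (by gcongr; exact le_self_add)
    push Not at hend
    obtain ⟨u, hu, hadm, d, hd⟩ := hu
    cases u with
    | nil => exact absurd (hend d) hd
    | cons c u =>
      have hc := hadm.2.start
      have h1 := volume_le_child hc hM (by linarith) (hKM _ (winner_not s.ex c ▸ hend (!c)))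
      have h2 := h' (s.child c hc) (growth * M) A (rate_child_le hc hM) hA (fun a ha => by
        have := rate_le_rate_child hc a
        calc growth * M ≤ growth * (K * s.rate a) :=
              mul_le_mul_of_nonneg_left (hKM a ha) (by linarith)
          _ = growth * K * s.rate a := by ring
          _ ≤ _ := mul_le_mul_of_nonneg_left this (by nlinarith))
        ⟨u, by simpa using hu, hadm.2, d, hd⟩
      calc volume s.region
          ≤ ENNReal.ofReal ((1 + growth * K) ^ 6) * (C' * volume (s.region ∩ s.hits w)) := by
            refine h1.trans (mul_le_mul_right (h2.trans (mul_le_mul_right ?_ _)) _)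
            exact (volume_child_hits_le hc w).trans (measure_mono Set.inter_subset_left)
        _ ≤ _ := by
            rw [← mul_assoc]
            gcongr
            exact le_add_self

theorem bound_of_bound_succ {w : List Bool} {j : ℕ} (hj7 : j < 7) (hj : Bound area w (j + 1)) :
    Bound area w j := by
  intro K hK
  obtain ⟨C, hC, h⟩ := exists_volume_le_of_path hj 407 K hK
  obtain ⟨C', hC', h'⟩ := hj K hK
  refine ⟨C + C', ENNReal.add_ne_top.2 ⟨hC, hC'⟩, fun s M A hM hA hKM => ?_⟩
  by_cases hb : ∃ b, b ∉ A
  · obtain ⟨b, hb⟩ := hb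
    obtain ⟨u, hu, hadm, c, hc⟩ := s.returning.exists_path_to b
    exact (h s M A hM hA hKM ⟨u, hu, hadm, c, hc ▸ hb⟩).trans (by gcongr; exact le_self_add)
  · push Not at hb
    have hA' : A = Finset.univ := Finset.eq_univ_iff_forall.2 hb
    refine (h' s M A hM ?_ hKM).trans (by gcongr; exact le_add_self)
    rw [hA', Finset.card_univ, Fintype.card_fin]
    omega

/-- The probability to see `w` is bounded below, uniformly in all states. -/
theorem exists_volume_le_hits {w : List Bool} (hw : Admissible w standard) : ∃ C : ℝ≥0∞, C ≠ ∞ ∧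
    ∀ s : State area, volume s.region ≤ C * volume (s.region ∩ s.hits w) := by
  have h : ∀ k ≤ 6, Bound area w (7 - k) := by
    intro k hk
    induction k with
    | zero => exact bound_seven hw
    | succ k ih =>
      refine bound_of_bound_succ (by omega) ?_
      have := ih (by omega)
      rwa [show 7 - (k + 1) + 1 = 7 - k by omega]
  obtain ⟨C, hC, h⟩ := h 6 le_rfl 1 le_rfl
  refine ⟨C, hC, fun s => ?_⟩
  obtain ⟨a, -, ha⟩ := Finset.exists_max_image Finset.univ s.rate ⟨0, Finset.mem_univ 0⟩
  exact h s (s.rate a) {a} (fun b => ha b (Finset.mem_univ b)) (by simp) (by simp)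

end State

/-! ### The exceptional set -/

theorem isClosed_cone (τ : IntervalExchange (Fin 7)) : IsClosed τ.cone := by
  have h1 : Continuous τ.excess := by
    have : τ.excess = fun w => ∑ a, (τ.top.count a : ℝ) * w a - ∑ a, (τ.bot.count a : ℝ) * w a := by
      funext w
      rw [excess, sum_map_eq_sum_count, sum_map_eq_sum_count]
    rw [this]
    fun_prop
  have h2 : IsClosed {w : Fin 7 → ℝ | ∀ a, 0 ≤ w a} := by
    simp only [Set.ofPred_forall]
    exact isClosed_iInter fun a => isClosed_le continuous_const (continuous_apply a)
  exact h2.inter (isClosed_eq h1 continuous_const)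

namespace State

theorem isClosed_region (s : State area) : IsClosed s.region :=
  ((isClosed_cone s.ex).preimage (LinearMap.continuous_of_finiteDimensional s.chart)).inter
    (isClosed_le (LinearMap.continuous_of_finiteDimensional area) continuous_const)

/-- The parameters of the weights whose first `k` splitting steps are strict and form a word in
`W`. -/
def follows (s : State area) (k : ℕ) (W : Set (List Bool)) : Set (Fin 6 → ℝ) :=
  {x | x ∈ s.region ∧ ∃ u ∈ W, u.length = k ∧ s.chart x ∈ cylinder u s.ex}

theorem mem_follows_child {s : State area} {c : Bool} (h : (s.ex.move c).Returning) {k : ℕ}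
    {W : Set (List Bool)} {x : Fin 6 → ℝ} (hs : x ∈ s.strict c) :
    x ∈ (s.child c h).follows k {u | c :: u ∈ W} ↔ x ∈ s.follows (k + 1) W := by
  constructor
  · rintro ⟨h1, u, hu, hk, hx⟩
    exact ⟨(mem_region_child.1 h1).1, c :: u, hu, by simp [hk], hs, hx⟩
  · rintro ⟨h1, u, hu, hk, hx⟩
    refine ⟨mem_region_child.2 ⟨h1, le_of_lt hs⟩, ?_⟩
    cases u with
    | nil => simp at hk
    | cons d u =>
      obtain ⟨h3, h4⟩ := hx
      have : c = d := by
        have hs : s.chart x (s.ex.loser c) < s.chart x (s.ex.winner c) := hs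
        cases c <;> cases d <;> first | rfl | exact absurd hs (not_lt.2 (le_of_lt h3))
      subst this
      exact ⟨u, hu, by simpa using hk, h4⟩

/-- In a union of cylinders of the same length, the proportion of the parameters that are not seen
to follow `w` is at most as large as it can be in a single region. -/
theorem volume_follows_diff_hits_le {w : List Bool} {κ : ℝ≥0∞}
    (hκ : ∀ s : State area, volume (s.region \ s.hits w) ≤ κ * volume s.region) (k : ℕ) :
    ∀ (s : State area) (W : Set (List Bool)),
      volume (s.follows k W \ s.hits w) ≤ κ * volume (s.follows k W) := by
  induction k with
  | zero =>
    intro s W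
    by_cases hW : [] ∈ W
    · have : s.follows 0 W = s.region := by
        ext x
        refine ⟨fun h => h.1, fun h => ⟨h, [], hW, rfl, trivial⟩⟩
      rw [this]
      exact hκ s
    · have : s.follows 0 W = ∅ := by
        rw [Set.eq_empty_iff_forall_notMem]
        rintro x ⟨-, u, hu, hk, -⟩
        exact hW (List.length_eq_zero_iff.1 hk ▸ hu)
      rw [this]
      simp
  | succ k ih =>
    intro s W
    refine s.volume_le_of_children κ (fun x hx => hx.1.1) fun c hc => ?_
    calc volume ((s.follows (k + 1) W \ s.hits w) ∩ s.strict c)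
        ≤ volume ((s.child c hc).follows k {u | c :: u ∈ W} \ (s.child c hc).hits w) := by
          refine measure_mono fun x hx => ⟨(mem_follows_child hc hx.2).2 hx.1.1, fun h => ?_⟩
          exact hx.1.2 (mem_seen_of_cut s.returning hx.2 h)
      _ ≤ κ * volume ((s.child c hc).follows k {u | c :: u ∈ W}) := ih _ _
      _ ≤ κ * volume (s.follows (k + 1) W ∩ s.strict c) := by
          refine mul_le_mul_right (volume_le_inter_strict hc (fun x hx => hx.1) ?_) _
          exact fun x hx => (mem_follows_child hc hx.2).1 hx.1

/-- Almost all splitting sequences are strict forever. -/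
theorem volume_not_follows (k : ℕ) : ∀ s : State area,
    volume (s.region \ s.follows k Set.univ) = 0 := by
  induction k with
  | zero =>
    intro s
    have : s.region \ s.follows 0 Set.univ = ∅ :=
      Set.sdiff_eq_empty.2 fun x hx => ⟨hx, [], trivial, rfl, trivial⟩
    simp [this]
  | succ k ih =>
    intro s
    have := s.volume_le_of_children (X := s.region \ s.follows (k + 1) Set.univ) (Y := ∅) 0
      Set.sdiff_subset fun c hc => by
        rw [zero_mul, nonpos_iff_eq_zero]
        refine measure_mono_null (fun x hx => ?_) (ih (s.child c hc))
        exact ⟨mem_region_child.2 ⟨hx.1.1, le_of_lt hx.2⟩,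
          fun h => hx.1.2 ((mem_follows_child hc hx.2).1 h)⟩
    simpa using this

/-- Almost all weights are seen to follow `w`. -/
theorem volume_region_diff_hits {w : List Bool} (hw : Admissible w standard) (s : State area) :
    volume (s.region \ s.hits w) = 0 := by
  obtain ⟨C, hC, hbound⟩ := exists_volume_le_hits (area := area) hw
  have hfin : volume s.region ≠ ∞ := s.volume_ne_top
  set κ := C / (C + 1) with hκdef
  have hκ1 : κ < 1 := by
    rw [hκdef, ENNReal.div_lt_iff (by simp) (by simp [hC]), one_mul]
    exact ENNReal.lt_add_right hC one_ne_zero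
  have hκ : ∀ s : State area, volume (s.region \ s.hits w) ≤ κ * volume s.region := by
    intro s
    have h1 := hbound s
    have h2 := measure_inter_add_sdiff (μ := volume) s.region (s.measurableSet_hits w)
    rw [hκdef, div_eq_mul_inv, mul_right_comm, ← div_eq_mul_inv,
      ENNReal.le_div_iff_mul_le (by simp) (by simp [hC]), mul_add, mul_one, ← h2, mul_add, mul_comm,
      add_comm]
    gcongr
    exact le_trans (by rw [← h2]; exact le_add_self) h1
  let G : ℕ → Set (Fin 6 → ℝ) := fun m => {x | ∃ u e, u.length ≤ m ∧ Admissible u s.ex ∧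
    run u s.ex = standard.relabel e ∧ s.chart x ∈ cylinder (u ++ w) s.ex}
  have hGmeas : ∀ m, MeasurableSet (G m) := by
    intro m
    have : G m = ⋃ u : List Bool, ⋃ _ : u.length ≤ m ∧ Admissible u s.ex ∧
        ∃ e, run u s.ex = standard.relabel e,
        s.chart ⁻¹' cylinder (u ++ w) s.ex := by
      ext x
      simp only [G, Set.mem_ofPred_eq, Set.mem_iUnion, Set.mem_preimage]
      grind
    rw [this]
    exact (isOpen_iUnion fun u => isOpen_iUnion fun _ => (isOpen_cylinder _ _).preimage
      (LinearMap.continuous_of_finiteDimensional s.chart)).measurableSet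
  have hmono : Monotone G := fun m n hmn x ⟨u, e, hu, h⟩ => ⟨u, e, hu.trans hmn, h⟩
  have hUnion : s.hits w = ⋃ m, G m := by
    ext x
    rw [Set.mem_iUnion]
    exact ⟨fun ⟨u, e, h⟩ => ⟨u.length, u, e, le_rfl, h⟩, fun ⟨m, u, e, _, h⟩ => ⟨u, e, h⟩⟩
  have hle : ∀ m, volume (s.region \ s.hits w) ≤ κ * volume (s.region \ G m) := by
    intro m
    -- the words that do not contain a copy of `w` that starts at time `m` or earlier
    let W : Set (List Bool) := {v | ∀ u e, u.length ≤ m → Admissible u s.ex →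
      run u s.ex = standard.relabel e → ¬ (u ++ w) <+: v}
    have h1 : s.region \ s.hits w ⊆ (s.follows (m + w.length) W \ s.hits w) ∪
        (s.region \ s.follows (m + w.length) Set.univ) := by
      rintro x ⟨hx, hxw⟩
      by_cases h : x ∈ s.follows (m + w.length) Set.univ
      · obtain ⟨-, v, -, hv, hxv⟩ := h
        refine .inl ⟨⟨hx, v, fun u e hu hadm he hpre => ?_, hv, hxv⟩, hxw⟩
        exact hxw ⟨u, e, hadm, he, mem_cylinder_of_prefix hpre hxv⟩
      · exact .inr ⟨hx, h⟩
    have h2 : s.follows (m + w.length) W ⊆ s.region \ G m := by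
      rintro x ⟨hx, v, hvW, hv, hxv⟩
      refine ⟨hx, fun ⟨u, e, hu, hadm, he, hxu⟩ => hvW u e hu hadm he (cylinder_prefix hxu hxv ?_)⟩
      rw [List.length_append]; omega
    calc volume (s.region \ s.hits w)
        ≤ volume (s.follows (m + w.length) W \ s.hits w) +
            volume (s.region \ s.follows (m + w.length) Set.univ) :=
          (measure_mono h1).trans (measure_union_le _ _)
      _ = volume (s.follows (m + w.length) W \ s.hits w) := by rw [volume_not_follows, add_zero]
      _ ≤ κ * volume (s.follows (m + w.length) W) := volume_follows_diff_hits_le hκ _ _ _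
      _ ≤ κ * volume (s.region \ G m) := mul_le_mul_right (measure_mono h2) _
  have hlim : Tendsto (fun m => volume (s.region \ G m)) atTop
      (𝓝 (volume (s.region \ s.hits w))) := by
    rw [hUnion, Set.sdiff_iUnion]
    refine tendsto_measure_iInter_atTop
      (fun m => (s.isClosed_region.measurableSet.diff (hGmeas m)).nullMeasurableSet)
      (fun m n hmn => Set.sdiff_subset_sdiff_right (hmono hmn))
      ⟨0, ne_top_of_le_ne_top hfin (measure_mono Set.sdiff_subset)⟩
  have hfinal : volume (s.region \ s.hits w) ≤ κ * volume (s.region \ s.hits w) :=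
    ge_of_tendsto' (ENNReal.Tendsto.const_mul hlim (.inr (hκ1.trans ENNReal.one_lt_top).ne)) hle
  by_contra hne
  have hlt : κ * volume (s.region \ s.hits w) < 1 * volume (s.region \ s.hits w) :=
    ENNReal.mul_lt_mul_left hne (ne_top_of_le_ne_top hfin (measure_mono Set.sdiff_subset)) hκ1
  rw [one_mul] at hlt
  exact absurd hfinal (not_le.2 hlt)

end State

/-! ### Strict splitting sequences -/

theorem split_eq_move {τ : IntervalExchange (Fin 7)} (hτ : τ.Returning) {c : Bool} {w : Fin 7 → ℝ}
    (h : w (τ.loser c) < w (τ.winner c)) : split (τ, w) = some (τ.move c, cut c τ w) := by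
  have h1 : τ.top.getLast? = some τ.lastTop := by
    conv_lhs => rw [← dropLast_append_lastTop hτ.top_ne_nil]
    simp
  have h2 : τ.bot.getLast? = some τ.lastBot := by
    conv_lhs => rw [← dropLast_append_lastBot hτ.bot_ne_nil]
    simp
  simp only [split, h1, h2]
  cases c
  · have h : w τ.lastTop < w τ.lastBot := h
    rw [if_neg h.not_gt, if_pos h]
    rfl
  · have h : w τ.lastBot < w τ.lastTop := h
    rw [if_pos h]
    rfl

/-- On a cylinder the splitting sequence is given by the word that defines the cylinder. -/
theorem splitSeq_eq_run {u : List Bool} : ∀ {τ : IntervalExchange (Fin 7)} {w : Fin 7 → ℝ},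
    Admissible u τ → w ∈ cylinder u τ → ∀ k ≤ u.length,
      (splitSeq τ w k).map Prod.fst = some (run (u.take k) τ) := by
  induction u with
  | nil =>
    intro τ w _ _ k hk
    rw [Nat.le_zero.1 hk]
    rfl
  | cons c u ih =>
    intro τ w hadm hw k hk
    cases k with
    | zero => rfl
    | succ k =>
      have h : splitSeq τ w (k + 1) = splitSeq (τ.move c) (cut c τ w) k := by
        rw [splitSeq, Function.iterate_succ_apply, Option.bind_some, split_eq_move hadm.1 hw.1,
          splitSeq]
      rw [h]
      exact ih hadm.2 hw.2 k (by simpa using hk)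

theorem exhibits_of_mem_seen {n : ℕ} {σ : Fin (n + 1) → IntervalExchange (Fin 7)} {s : List Bool}
    (hs : Admissible s standard) (hn : s.length = n)
    (hσ : ∀ i : Fin (n + 1), run (s.take i) standard = σ i) {w : Fin 7 → ℝ}
    (hw : w ∈ seen s standard) : standard.Exhibits w σ := by
  obtain ⟨u, e, hadm, he, hu⟩ := hw
  refine ⟨u.length, e, fun i => ?_⟩
  have hi := i.is_le
  have htake : Admissible (s.take i) standard := by
    rw [← List.take_append_drop i s, admissible_append] at hs
    exact hs.1
  rw [splitSeq_eq_run (admissible_append.2 ⟨hadm, he ▸ hs.relabel e⟩) hu _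
    (by rw [List.length_append]; omega), List.take_length_add_append, run_append, he,
    run_relabel htake, hσ]

/-! ### Complete exchanges of genus two -/

/-- A complete exchange of genus two has seven bands: if it has `m` bands, then the Euler
characteristic gives `m - 3` triangles, and all but at most two of the `2 * m` gaps are cusps, so
that `2 * m - 2 ≤ 3 * (m - 3)`. -/
theorem IsComplete.bands_eq_univ {τ : IntervalExchange (Fin 7)} (hτ : τ.IsComplete 2) :
    τ.bands = Finset.univ := by
  classical
  obtain ⟨hwf, hl, -, hcusps, heuler⟩ := hτ
  have hfin : Finite τ.Region := inferInstanceAs (Finite (Quot _))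
  have := Fintype.ofFinite τ.Region
  have hlen : τ.ends.length = 2 * τ.bands.card := by
    have h1 : τ.ends.toFinset = τ.bands := by
      ext a; simp [ends, bands]
    rw [← List.sum_toFinset_count_eq_length, h1, mul_comm, ← smul_eq_mul, ← Finset.sum_const]
    refine Finset.sum_congr rfl fun a ha => ?_
    have h2 := hwf a
    have h3 : 0 < τ.top.count a + τ.bot.count a := by
      rw [← List.count_append, List.count_pos_iff]
      simpa [bands] using ha
    rw [hl] at h2
    simp only [ends, List.count_append, List.count_reverse, List.count_nil] at h2 ⊢
    omega
  -- all gaps but at most two are cusps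
  have hle : τ.ends.length ≤ (Finset.univ.filter τ.IsCusp).card + 2 := by
    have h1 : (Finset.univ.filter fun i => ¬ τ.IsCusp i).card ≤ 2 := by
      have h2 : (Finset.univ.filter fun i : Fin τ.ends.length => ¬ τ.IsCusp i).image Fin.val ⊆
          {τ.top.length - 1, τ.ends.length - 1} := by
        intro k hk
        obtain ⟨i, hi, rfl⟩ := Finset.mem_image.1 hk
        have := (Finset.mem_filter.1 hi).2
        simp only [IsCusp, Finset.mem_insert, Finset.mem_singleton] at this ⊢
        omega
      rw [← Finset.card_image_of_injective _ Fin.val_injective]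
      exact (Finset.card_le_card h2).trans Finset.card_le_two
    have h3 := Finset.card_filter_add_card_filter_not (s := Finset.univ) τ.IsCusp
    rw [Finset.card_univ, Fintype.card_fin] at h3
    omega
  have hsum : (Finset.univ.filter τ.IsCusp).card = 3 * Fintype.card τ.Region := by
    let region (i : Fin τ.ends.length) : τ.Region := Quot.mk _ i
    rw [Finset.card_eq_sum_card_fiberwise (f := region) (t := Finset.univ)
      fun _ _ => Finset.mem_coe.2 (Finset.mem_univ _)]
    rw [Finset.sum_congr rfl (g := fun _ => 3), Finset.sum_const, Finset.card_univ, smul_eq_mul,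
      mul_comm]
    intro R _
    rw [← hcusps R, cusps, Nat.card_eq_fintype_card, Fintype.card_subtype, Finset.filter_filter]
    congr!
  rw [eulerChar, Nat.card_eq_fintype_card] at heuler
  rw [← Finset.card_eq_iff_eq_univ, Fintype.card_fin]
  have := Finset.card_le_univ τ.bands
  rw [Fintype.card_fin] at this
  omega

/-- A step between complete exchanges is strict. -/
theorem Returning.exists_move_eq {τ τ' : IntervalExchange (Fin 7)} (hτ : τ.Returning)
    (hs : τ.SplitsTo τ') (hτ' : τ'.IsComplete 2) : ∃ c, τ.move c = τ' ∧ τ'.Returning := by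
  obtain ⟨w, hw, w', hsplit⟩ := hs
  have key : ∀ c, τ.move c = τ' → τ'.Returning := by
    rintro c rfl
    obtain ⟨v, hv, hpos⟩ := hτ'.2.2.1
    refine hτ.move_of_pos (w := v) ⟨hv.1, sub_eq_zero.2 hv.2.2⟩ fun a => hpos a ?_
    rw [hτ'.bands_eq_univ]
    exact Finset.mem_univ a
  rcases lt_trichotomy (w τ.lastTop) (w τ.lastBot) with h | h | h
  · rw [split_eq_move (c := false) hτ h, Option.some_inj, Prod.mk.injEq] at hsplit
    exact ⟨false, hsplit.1, key _ hsplit.1⟩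
  · have h1 : τ.top.getLast? = some τ.lastTop := by
      conv_lhs => rw [← dropLast_append_lastTop hτ.top_ne_nil]
      simp
    have h2 : τ.bot.getLast? = some τ.lastBot := by
      conv_lhs => rw [← dropLast_append_lastBot hτ.bot_ne_nil]
      simp
    simp only [split, h1, h2, h, lt_irrefl, if_false, hτ.lastTop_ne_lastBot, Option.some_inj,
      Prod.mk.injEq] at hsplit
    have hmem : τ.lastBot ∈ τ'.bands := by
      rw [hτ'.bands_eq_univ]
      exact Finset.mem_univ _
    rw [← hsplit.1] at hmem
    simp only [bands, List.toFinset_append, Finset.mem_union, List.mem_toFinset,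
      List.mem_map] at hmem
    exfalso
    have hne := hτ.lastTop_ne_lastBot
    rcases hmem with ⟨a, -, ha⟩ | ⟨a, -, ha⟩ <;> split_ifs at ha <;> contradiction
  · rw [split_eq_move (c := true) hτ h, Option.some_inj, Prod.mk.injEq] at hsplit
    exact ⟨true, hsplit.1, key _ hsplit.1⟩

/-- A splitting sequence of complete exchanges is described by the types of its steps. -/
theorem exists_word {n : ℕ} {σ : Fin (n + 1) → IntervalExchange (Fin 7)} (h0 : σ 0 = standard)
    (hσ : ∀ i, (σ i).IsComplete 2) (hs : ∀ i : Fin n, (σ i.castSucc).SplitsTo (σ i.succ)) :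
    ∃ s : List Bool, Admissible s standard ∧ s.length = n ∧
      ∀ i : Fin (n + 1), run (s.take i) standard = σ i := by
  induction n with
  | zero =>
    refine ⟨[], standard_returning, rfl, fun i => ?_⟩
    obtain rfl : i = 0 := Subsingleton.elim (α := Fin 1) i 0
    rw [h0]
    rfl
  | succ n ih =>
    obtain ⟨s, hadm, hlen, hrun⟩ := ih (σ := fun i => σ i.castSucc) h0 (fun i => hσ _)
      (fun i => hs i.castSucc)
    have hlast : run s standard = σ (Fin.last n).castSucc := by
      rw [← hrun (Fin.last n), Fin.val_last, ← hlen, List.take_length]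
    obtain ⟨c, hc, hret⟩ := Returning.exists_move_eq (hlast ▸ hadm.run) (hs (Fin.last n)) (hσ _)
    refine ⟨s ++ [c], admissible_append.2 ⟨hadm, ?_⟩, by simp [hlen], fun i => ?_⟩
    · refine ⟨hadm.run, ?_⟩
      rw [hlast, hc]
      exact hret
    · rcases Fin.eq_castSucc_or_eq_last i with ⟨j, rfl⟩ | rfl
      · rw [← hrun j, Fin.val_castSucc, List.take_append_of_le_length (hlen ▸ j.is_le)]
      · rw [Fin.val_last, List.take_of_length_le (by simp [hlen]), run_append, hlast]
        exact hc


/-! ### Counting integral weights -/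

/-- The parametrization of the weights on `standard` by the widths of the first six bands. -/
def standardChart : (Fin 6 → ℝ) →ₗ[ℝ] (Fin 7 → ℝ) where
  toFun x := ![x 0, x 1, x 2, x 3, x 4, x 5, x 1 + x 2 + x 3 - x 4 - x 5]
  map_add' x y := by
    ext a
    fin_cases a <;> simp
    ring
  map_smul' r x := by
    ext a
    fin_cases a <;> simp
    ring

/-- The widths of the first six bands. -/
def coords (w : Fin 7 → ℝ) : Fin 6 → ℝ := fun i => w i.castSucc

theorem coords_standardChart (x : Fin 6 → ℝ) : coords (standardChart x) = x := by
  ext i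
  fin_cases i <;> rfl

theorem standardChart_coords {w : Fin 7 → ℝ} (hw : standard.excess w = 0) :
    standardChart (coords w) = w := by
  rw [excess_standard] at hw
  ext a
  fin_cases a <;> try rfl
  change w 1 + w 2 + w 3 - w 4 - w 5 = w 6
  linarith

theorem excess_standardChart (x : Fin 6 → ℝ) : standard.excess (standardChart x) = 0 := by
  rw [excess_standard]
  simp [standardChart]

theorem standard_ML : standard.ML = standard.cone := by
  ext w
  have h : ∀ a, a ∈ standard.bands := by decide
  simp only [ML, cone, Set.mem_ofPred_eq, h, not_true_eq_false, false_imp_iff, implies_true,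
    true_and, excess, sub_eq_zero]

/-- The total width of the bands, multiplied by `r`. -/
noncomputable def totalWidth (r : ℝ) : (Fin 6 → ℝ) →ₗ[ℝ] ℝ :=
  r • ∑ a, LinearMap.proj a ∘ₗ standardChart

theorem totalWidth_apply (r : ℝ) (x : Fin 6 → ℝ) :
    totalWidth r x = ∑ a, r * standardChart x a := by
  simp [totalWidth, Finset.mul_sum]

theorem standard_region_subset {r : ℝ} (hr : 0 < r) :
    {x | standardChart x ∈ standard.cone ∧ totalWidth r x ≤ 1} ⊆
      Set.Icc (0 : Fin 6 → ℝ) fun _ => r⁻¹ := by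
  rintro x ⟨hx, hx1⟩
  have key : ∀ i : Fin 6, 0 ≤ x i ∧ x i ≤ r⁻¹ := by
    intro i
    have h1 : x i = standardChart x i.castSucc := (congrFun (coords_standardChart x) i).symm
    have h0 := hx.1 i.castSucc
    rw [h1]
    refine ⟨h0, ?_⟩
    rw [totalWidth_apply] at hx1
    have h2 := (Finset.single_le_sum (f := fun a => r * standardChart x a)
      (fun a _ => mul_nonneg hr.le (hx.1 a)) (Finset.mem_univ i.castSucc)).trans hx1
    rwa [← one_div, le_div_iff₀' hr]
  exact ⟨fun i => (key i).1, fun i => (key i).2⟩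

/-- The initial state, in which all bands have length `r`. -/
noncomputable def State.initial (r : ℝ) (hr : 0 < r) : State (totalWidth r) where
  ex := standard
  chart := standardChart
  len := fun _ => r
  returning := standard_returning
  range_iff w := ⟨fun ⟨x, hx⟩ => hx ▸ excess_standardChart x,
    fun h => ⟨coords w, standardChart_coords h⟩⟩
  len_pos _ := hr
  sum_eq x := (totalWidth_apply r x).symm
  volume_ne_top := ne_top_of_le_ne_top (isCompact_Icc.measure_lt_top (μ := volume)).ne
    (measure_mono (standard_region_subset hr))

/-- The lattice of integral points. -/
abbrev lattice : Submodule ℤ (Fin 6 → ℝ) := Submodule.span ℤ (Set.range (Pi.basisFun ℝ (Fin 6)))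

theorem mem_lattice {x : Fin 6 → ℝ} : x ∈ lattice ↔ ∀ i, ∃ k : ℤ, x i = k := by
  rw [Module.Basis.mem_span_iff_repr_mem]
  simp [eq_comm]

theorem finite_smul_inter_lattice {s : Set (Fin 6 → ℝ)} (hs : Bornology.IsBounded s) (t : ℝ) :
    (t • s ∩ (lattice : Set (Fin 6 → ℝ))).Finite :=
  ZSpan.setFinite_inter _ (hs.smul₀ t)

theorem injOn_coords : Set.InjOn coords standard.MLInt := by
  intro v hv w hw h
  rw [MLInt, standard_ML] at hv hw
  rw [← standardChart_coords hv.1.2, h, standardChart_coords hw.1.2]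

theorem coords_smul (t : ℝ) (w : Fin 7 → ℝ) : coords (t • w) = t • coords w := rfl

/-- The coordinates of the integral weights in a multiple of `U` are lattice points in the same
multiple of any set that contains the coordinates of the weights in `U`. -/
theorem mapsTo_coords {U : Set (Fin 7 → ℝ)} {s : Set (Fin 6 → ℝ)} (hU : ∀ u ∈ U, coords u ∈ s)
    (t : ℝ) : Set.MapsTo coords (standard.MLInt ∩ t • U) (t • s ∩ (lattice : Set (Fin 6 → ℝ))) := by
  rintro _ ⟨hγ, u, hu, rfl⟩
  exact ⟨⟨coords u, hU u hu, coords_smul t u⟩, mem_lattice.2 fun i => hγ.2 i.castSucc⟩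

theorem card_smul_inter_lattice (s : Set (Fin 6 → ℝ)) {t : ℝ} (ht : t ≠ 0) :
    (t • s ∩ (lattice : Set (Fin 6 → ℝ))).ncard =
      Nat.card ↑(s ∩ t⁻¹ • (lattice : Set (Fin 6 → ℝ))) := by
  have h : t • s ∩ (lattice : Set (Fin 6 → ℝ)) =
      (t • ·) '' (s ∩ t⁻¹ • (lattice : Set (Fin 6 → ℝ))) := by
    rw [Set.image_smul, Set.smul_set_inter₀ ht, smul_inv_smul₀ ht]
  rw [h, Set.ncard_image_of_injective _ (smul_right_injective _ ht), Nat.card_coe_set_eq]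

/-- A relatively open set of weights contains many multiples of integral weights. -/
theorem exists_le_ncard {U : Set (Fin 7 → ℝ)} (hU : U ⊆ standard.ML)
    (hopen : IsOpen ((↑) ⁻¹' U : Set standard.ML)) (hbdd : Bornology.IsBounded (coords '' U))
    (hne : U.Nonempty) :
    ∃ c : ℝ, 0 < c ∧ ∀ᶠ t : ℝ in atTop, c * t ^ 6 ≤ ((standard.MLInt ∩ t • U).ncard : ℝ) := by
  obtain ⟨O, hO, hOU⟩ := isOpen_induced_iff.1 hopen
  have hmem : ∀ w ∈ standard.cone, w ∈ O → w ∈ U := fun w hw hwO => by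
    have : (⟨w, standard_ML ▸ hw⟩ : standard.ML) ∈ ((↑) ⁻¹' O : Set standard.ML) := hwO
    rwa [hOU] at this
  -- a point of `U` all of whose coordinates are positive
  obtain ⟨x, hxO, hxpos⟩ : ∃ x, standardChart x ∈ O ∧ ∀ a, 0 < standardChart x a := by
    obtain ⟨u, hu⟩ := hne
    have huO : u ∈ O := by
      have : (⟨u, hU hu⟩ : standard.ML) ∈ ((↑) ⁻¹' U : Set standard.ML) := hu
      rwa [← hOU] at this
    have hucone : u ∈ standard.cone := standard_ML ▸ hU hu
    obtain ⟨v, hv, hb⟩ := standard_returning.exists_weight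
    have hcont : Tendsto (fun r : ℝ => u + r • v) (𝓝[>] 0) (𝓝 u) := by
      have : Continuous fun r : ℝ => u + r • v := by fun_prop
      simpa using (this.tendsto 0).mono_left nhdsWithin_le_nhds
    obtain ⟨r, hr, hr0⟩ := ((hcont.eventually (hO.mem_nhds huO)).and self_mem_nhdsWithin).exists
    have hr0 : 0 < r := hr0
    have hcone : u + r • v ∈ standard.cone := add_mem_cone hucone (smul_mem_cone hr0.le hv)
    refine ⟨coords (u + r • v), ?_, fun a => ?_⟩
    · rwa [standardChart_coords hcone.2]
    · rw [standardChart_coords hcone.2]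
      exact add_pos_of_nonneg_of_pos (hucone.1 a) (mul_pos hr0 (one_pos.trans_le (hb a).1))
  have hcont : Continuous standardChart := LinearMap.continuous_of_finiteDimensional _
  have hopen' : IsOpen {y | standardChart y ∈ O ∧ ∀ a, 0 < standardChart y a} := by
    simp only [Set.ofPred_and, Set.ofPred_forall]
    exact (hO.preimage hcont).inter (isOpen_iInter_of_finite fun a =>
      isOpen_lt continuous_const ((continuous_apply a).comp hcont))
  obtain ⟨ε, hε, hball⟩ := Metric.isOpen_iff.1 hopen' x ⟨hxO, hxpos⟩
  refine ⟨(ε / 4) ^ 6, by positivity, ?_⟩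
  filter_upwards [eventually_ge_atTop (4 / ε), eventually_gt_atTop 0] with t ht ht0
  have hfin : (standard.MLInt ∩ t • U).Finite :=
    Set.Finite.of_injOn (mapsTo_coords (fun u hu => Set.mem_image_of_mem coords hu) t)
      (injOn_coords.mono Set.inter_subset_left) (finite_smul_inter_lattice hbdd t)
  let m : ℕ := ⌊t * ε / 2⌋₊
  let box : Finset (Fin 6 → ℤ) := Fintype.piFinset fun i => Finset.Ico ⌈t * x i⌉ (⌈t * x i⌉ + m)
  have hcard : box.card = m ^ 6 := by simp [box]
  let φ : (Fin 6 → ℤ) → Fin 7 → ℝ := fun z => standardChart fun i => (z i : ℝ)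
  have hφ : Function.Injective φ := by
    intro y z h
    have := congrArg coords h
    simp only [φ, coords_standardChart] at this
    ext i
    exact_mod_cast congrFun this i
  have hsub : φ '' box ⊆ standard.MLInt ∩ t • U := by
    rintro _ ⟨z, hz, rfl⟩
    have hz := Fintype.mem_piFinset.1 (Finset.mem_coe.1 hz)
    have hmem' : t⁻¹ • (fun i => (z i : ℝ)) ∈ Metric.ball x ε := by
      rw [Metric.mem_ball, dist_pi_lt_iff hε]
      intro i
      obtain ⟨h1, h2⟩ := Finset.mem_Ico.1 (hz i)
      have h1' : t * x i ≤ z i := Int.ceil_le.1 h1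
      have h2' : (z i : ℝ) < t * x i + t * ε := by
        have h3 : (z i : ℝ) + 1 ≤ ⌈t * x i⌉ + m := by exact_mod_cast h2
        have h4 := Int.ceil_lt_add_one (t * x i)
        have h5 : (m : ℝ) ≤ t * ε / 2 := Nat.floor_le (by positivity)
        have h6 : 0 < t * ε := by positivity
        linarith
      have h7 : t⁻¹ * z i - x i = (z i - t * x i) / t := by field_simp
      rw [Real.dist_eq, Pi.smul_apply, smul_eq_mul, h7, abs_lt]
      constructor
      · exact (neg_lt_zero.2 hε).trans_le (div_nonneg (by linarith) ht0.le)
      · rw [div_lt_iff₀ ht0]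
        linarith
    obtain ⟨hzO, hzpos⟩ := hball hmem'
    have hφz : φ z = t • standardChart (t⁻¹ • fun i => (z i : ℝ)) := by
      rw [map_smul, smul_inv_smul₀ ht0.ne']
    have hcone : standardChart (t⁻¹ • fun i => (z i : ℝ)) ∈ standard.cone :=
      ⟨fun a => (hzpos a).le, excess_standardChart _⟩
    refine ⟨⟨?_, ?_⟩, ?_⟩
    · rw [standard_ML, hφz]
      exact smul_mem_cone ht0.le hcone
    · intro a
      fin_cases a
      · exact ⟨z 0, rfl⟩
      · exact ⟨z 1, rfl⟩
      · exact ⟨z 2, rfl⟩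
      · exact ⟨z 3, rfl⟩
      · exact ⟨z 4, rfl⟩
      · exact ⟨z 5, rfl⟩
      · exact ⟨z 1 + z 2 + z 3 - z 4 - z 5, by push_cast; rfl⟩
    · exact ⟨_, hmem _ hcone hzO, hφz.symm⟩
  have h1 : m ^ 6 ≤ (standard.MLInt ∩ t • U).ncard := by
    rw [← hcard, ← Set.ncard_coe_finset, ← Set.ncard_image_of_injective _ hφ]
    exact Set.ncard_le_ncard hsub hfin
  have h2 : t * (ε / 4) ≤ m := by
    have h3 : t * ε / 2 < m + 1 := Nat.lt_floor_add_one _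
    have h4 : 4 ≤ t * ε := (div_le_iff₀ hε).1 ht
    linarith
  calc (ε / 4) ^ 6 * t ^ 6 = (t * (ε / 4)) ^ 6 := by ring
    _ ≤ (m : ℝ) ^ 6 := pow_le_pow_left₀ (by positivity) h2 6
    _ ≤ _ := by exact_mod_cast h1

/-- Integral weights that are not seen to follow `s` are negligible. -/
theorem tendsto_card_not_seen {s : List Bool} (hs : Admissible s standard) {r : ℝ} (hr : 0 < r) :
    Tendsto (fun t : ℝ => ((t • ((State.initial r hr).region \ (State.initial r hr).hits s) ∩
      (lattice : Set (Fin 6 → ℝ))).ncard : ℝ) / t ^ 6) atTop (𝓝 0) := by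
  set S := State.initial r hr
  have hclosed : IsClosed (S.region \ S.hits s) := S.isClosed_region.sdiff
    ((isOpen_seen s S.ex).preimage (LinearMap.continuous_of_finiteDimensional S.chart))
  have hbdd : Bornology.IsBounded (S.region \ S.hits s) :=
    (Metric.isBounded_Icc _ _).subset (Set.sdiff_subset.trans (standard_region_subset hr))
  have hnull := S.volume_region_diff_hits hs
  have hstar : ∀ ⦃x y : ℝ⦄, 0 < x → x ≤ y →
      x • (S.region \ S.hits s) ⊆ y • (S.region \ S.hits s) := by
    rintro x y hx hxy _ ⟨p, ⟨⟨hp, hp1⟩, hps⟩, rfl⟩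
    have hy : 0 < y := hx.trans_le hxy
    have hq : 0 < y⁻¹ * x := by positivity
    refine ⟨(y⁻¹ * x) • p, ⟨⟨?_, ?_⟩, fun hmem => hps ?_⟩, ?_⟩
    · rw [map_smul]
      exact smul_mem_cone hq.le hp
    · rw [map_smul, smul_eq_mul]
      have h1 : y⁻¹ * x ≤ 1 := by rwa [inv_mul_le_one₀ hy]
      have h0 : 0 ≤ totalWidth r p := by
        rw [← S.sum_eq]
        exact S.dot_nonneg hp
      nlinarith
    · have hmem : S.chart ((y⁻¹ * x) • p) ∈ seen s S.ex := hmem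
      have := smul_mem_seen (inv_pos.2 hq) hmem
      rwa [map_smul, inv_smul_smul₀ hq.ne'] at this
    · simp only [smul_smul]
      rw [mul_inv_cancel_left₀ hy.ne']
  have h := tendsto_card_div_pow_atTop_volume' (S.region \ S.hits s) hbdd hclosed.measurableSet
    (measure_mono_null hclosed.frontier_subset hnull) hstar
  rw [measureReal_def, hnull, ENNReal.toReal_zero, Fintype.card_fin] at h
  refine h.congr' ?_
  filter_upwards [eventually_gt_atTop 0] with t ht
  rw [card_smul_inter_lattice _ ht.ne']

end IntervalExchange

theorem theorem10p1 (n : ℕ) (σ : Fin (n + 1) → IntervalExchange (Fin 7))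
    (hσ_zero : σ 0 = IntervalExchange.standard)
    (hσ_complete : ∀ i, (σ i).IsComplete 2)
    (hσ_split : ∀ i : Fin n, (σ i.castSucc).SplitsTo (σ i.succ))
    (U : Set (Fin 7 → ℝ))
    (hU_sub : U ⊆ IntervalExchange.standard.ML)
    (hU_open : IsOpen ((↑) ⁻¹' U : Set IntervalExchange.standard.ML))
    (hU_bdd : Bornology.IsBounded U) (hU_ne : U.Nonempty) :
    Tendsto (fun t : ℝ =>
      (({γ ∈ IntervalExchange.standard.MLInt |
          IntervalExchange.standard.Exhibits γ σ} ∩ t • U).ncard : ℝ) /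
        ((IntervalExchange.standard.MLInt ∩ t • U).ncard : ℝ))
      atTop (𝓝 1) := by
  open IntervalExchange in
  obtain ⟨s, hs, hlen, hrun⟩ := exists_word hσ_zero hσ_complete hσ_split
  -- the total width is bounded on `U`
  obtain ⟨r, hr, hUr⟩ : ∃ r : ℝ, ∃ hr : 0 < r, ∀ u ∈ U, coords u ∈ (State.initial r hr).region := by
    obtain ⟨R, hR, hUR⟩ := hU_bdd.exists_pos_norm_le
    have h7R : (0 : ℝ) < 7 * R := by positivity
    refine ⟨(7 * R)⁻¹, inv_pos.2 h7R, fun u hu => ?_⟩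
    have hcone : u ∈ standard.cone := standard_ML ▸ hU_sub hu
    have h1 : standardChart (coords u) = u := standardChart_coords hcone.2
    refine ⟨show standardChart (coords u) ∈ standard.cone from h1.symm ▸ hcone, ?_⟩
    rw [totalWidth_apply, h1, ← Finset.mul_sum, inv_mul_le_one₀ h7R]
    calc ∑ a, u a ≤ ∑ _a : Fin 7, R := Finset.sum_le_sum fun a _ =>
          (le_abs_self _).trans ((norm_le_pi_norm u a).trans (hUR u hu))
      _ = 7 * R := by simp
  set S := State.initial r hr
  have hSbdd : Bornology.IsBounded S.region :=
    (Metric.isBounded_Icc _ _).subset (standard_region_subset hr)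
  have hfin : ∀ t : ℝ, (standard.MLInt ∩ t • U).Finite := fun t =>
    Set.Finite.of_injOn (mapsTo_coords hUr t) (injOn_coords.mono Set.inter_subset_left)
      (finite_smul_inter_lattice hSbdd t)
  obtain ⟨c, hc, hcU⟩ := exists_le_ncard hU_sub hU_open
    (hSbdd.subset (Set.image_subset_iff.2 hUr)) hU_ne
  -- the integral weights that do not exhibit the sequence
  let bad : ℝ → Set (Fin 7 → ℝ) := fun t =>
    (standard.MLInt ∩ t • U) \ {γ | standard.Exhibits γ σ}
  have hbad : ∀ t : ℝ, 0 < t →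
      (bad t).ncard ≤ (t • (S.region \ S.hits s) ∩ (lattice : Set (Fin 6 → ℝ))).ncard := by
    intro t ht
    refine Set.ncard_le_ncard_of_injOn coords ?_
      (injOn_coords.mono (Set.sdiff_subset.trans Set.inter_subset_left))
      (finite_smul_inter_lattice (hSbdd.subset Set.sdiff_subset) t)
    rintro _ ⟨⟨hγ, u, hu, rfl⟩, hnot⟩
    have hcone : u ∈ standard.cone := standard_ML ▸ hU_sub hu
    refine ⟨⟨coords u, ⟨hUr u hu, fun hmem => hnot ?_⟩, coords_smul t u⟩,
      (mapsTo_coords hUr t ⟨hγ, u, hu, rfl⟩).2⟩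
    have hmem : standardChart (coords u) ∈ seen s standard := hmem
    rw [standardChart_coords hcone.2] at hmem
    exact exhibits_of_mem_seen hs hlen hrun (smul_mem_seen ht hmem)
  have hlim : Tendsto (fun t : ℝ => ((bad t).ncard : ℝ) / ((standard.MLInt ∩ t • U).ncard : ℝ))
      atTop (𝓝 0) := by
    have h := (tendsto_card_not_seen hs hr).div_const c
    rw [zero_div] at h
    refine squeeze_zero' (Eventually.of_forall fun t => by positivity) ?_ h
    filter_upwards [hcU, eventually_gt_atTop 0] with t ht ht0
    have hpos : 0 < c * t ^ 6 := by positivity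
    rw [div_div, mul_comm _ c]
    exact div_le_div₀ (Nat.cast_nonneg _) (by exact_mod_cast hbad t ht0) hpos ht
  have hfinal := hlim.const_sub 1
  rw [sub_zero] at hfinal
  refine hfinal.congr' ?_
  filter_upwards [hcU, eventually_gt_atTop 0] with t ht ht0
  have hpos : (0 : ℝ) < ((standard.MLInt ∩ t • U).ncard : ℝ) := lt_of_lt_of_le (by positivity) ht
  have hsum : ({γ ∈ standard.MLInt | standard.Exhibits γ σ} ∩ t • U).ncard + (bad t).ncard =
      (standard.MLInt ∩ t • U).ncard := by
    rw [← Set.ncard_inter_add_ncard_sdiff_eq_ncard (standard.MLInt ∩ t • U)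
      {γ | standard.Exhibits γ σ} (hfin t)]
    congr 2
    ext γ
    exact ⟨fun h => ⟨⟨h.1.1, h.2⟩, h.1.2⟩, fun h => ⟨⟨h.1.1, h.2⟩, h.1.2⟩⟩
  rw [← hsum] at hpos ⊢
  push_cast at hpos ⊢
  field_simp
  ring
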